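/- Fix $r\in(0,\infty)$. For $n\ge 1$ and $\theta\in\mathbb R^n$ let $X\sim N_n(\theta,I)$ and $Y\sim N_n(\theta,rI)$ be independent, and write $p(y\mid\theta,r)$ for the density of $Y$. For a predictive density estimator $\hat p(y\mid x)$ (jointly measurable and, for every $x$, a probability density in $y$ with respect to Lebesgue measure) define the Kullback–Leibler risk $$\rho(\theta,\hat p)=E_\theta\int_{\mathbb R^n} p(y\mid\theta,r)\,\log\frac{p(y\mid\theta,r)}{\hat p(y\mid X)}\,dy\in[0,\infty].$$ For a prior $\pi$ on $\mathbb R^n$ let $B(\pi)=\inf_{\hat p}\int\rho(\theta,\hat p)\,\pi(d\theta)$ be its Bayes risk, and for $\Theta\subset\mathbb R^n$ let $R_N(\Theta)=\inf_{\hat p}\sup_{\theta\in\Theta}\rho(\theta,\hat p)$ be the minimax risk, both infima being over all such estimators. Put $\Theta_n[s]=\{\theta\in\mathbb R^n:\#\{i:\theta_i\ne0\}\le s\}$. Let $(s_n)$ be a sequence of real numbers with $s_n\to\infty$ and $s_n/n\to0$, let $\eta_n=s_n/n$, and set $$v_w=(1+r^{-1})^{-1},\qquad \lambda_e=\sqrt{2\log\bigl(\eta_n^{-1}(1-\eta_n)\bigr)},\qquad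 \lambda_f=\sqrt{v_w}\,\lambda_e$$ (these are well defined, with $0<\eta_n<1/2$, for all large $n$). Let $\pi_n^{\rm IID}$ be the prior on $\mathbb R^n$ under which the coordinates $\theta_1,\dots,\theta_n$ are i.i.d. with law $(1-\eta_n)\delta_0+\eta_n\delta_{\lambda_f}$. Then, as $n\to\infty$, this prior is asymptotically least favorable in the sense that $$B(\pi_n^{\rm IID})=R_N(\Theta_n[s_n])\,(1+o(1)),$$ where, for all large $n$, $0<R_N(\Theta_n[s_n])<\infty$ and $B(\pi_n^{\rm IID})<\infty$. -/

import Mathlib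

open Filter Topology MeasureTheory ProbabilityTheory
open scoped ENNReal NNReal

namespace SparsePrediction

noncomputable section

/-- The law `N_n(θ, v I)` on `ℝⁿ`: independent coordinates, the `i`-th one being `N(θ i, v)`. -/
def normalVec {n : ℕ} (θ : Fin n → ℝ) (v : ℝ≥0) : Measure (Fin n → ℝ) :=
  Measure.pi fun i => gaussianReal (θ i) v

/-- A measurable predictive density estimator `p̂(y | x)`: jointly measurable in `(x, y)` and,
for every `x`, a probability density in `y` with respect to Lebesgue measure. -/
structure PredictiveDensity (n : ℕ) where
  /-- `dens x y` is `p̂(y | x)`. -/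
  dens : (Fin n → ℝ) → (Fin n → ℝ) → ℝ
  measurable_dens : Measurable (Function.uncurry dens)
  dens_nonneg : ∀ x y, 0 ≤ dens x y
  lintegral_dens : ∀ x, ∫⁻ y, ENNReal.ofReal (dens x y) = 1

/-- The probability measure `p̂(y | x) dy`. -/
def PredictiveDensity.law {n : ℕ} (p : PredictiveDensity n) (x : Fin n → ℝ) :
    Measure (Fin n → ℝ) :=
  volume.withDensity fun y => ENNReal.ofReal (p.dens x y)

/-- Kullback–Leibler loss `L(θ, p̂(· | x)) = ∫ p(y | θ, r) log (p(y | θ, r) / p̂(y | x)) dy`, the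
KL divergence of `p̂(y | x) dy` from `N_n(θ, r I)`, with values in `[0, ∞]`. -/
def loss {n : ℕ} (r : ℝ≥0) (θ : Fin n → ℝ) (p : PredictiveDensity n) (x : Fin n → ℝ) : ℝ≥0∞ :=
  InformationTheory.klDiv (normalVec θ r) (p.law x)

/-- KL risk `ρ(θ, p̂)`: the expected loss when the past observation is `X ∼ N_n(θ, I)`. -/
def risk {n : ℕ} (r : ℝ≥0) (θ : Fin n → ℝ) (p : PredictiveDensity n) : ℝ≥0∞ :=
  ∫⁻ x, loss r θ p x ∂(normalVec θ 1)

/-- Integrated risk `B(π, p̂) = ∫ ρ(θ, p̂) π(dθ)`. -/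
def integratedRisk {n : ℕ} (r : ℝ≥0) (π : Measure (Fin n → ℝ)) (p : PredictiveDensity n) :
    ℝ≥0∞ :=
  ∫⁻ θ, risk r θ p ∂π

/-- Bayes KL risk `B(π) = inf_p̂ B(π, p̂)`. -/
def bayesRisk {n : ℕ} (r : ℝ≥0) (π : Measure (Fin n → ℝ)) : ℝ≥0∞ :=
  ⨅ p : PredictiveDensity n, integratedRisk r π p

/-- Minimax KL risk `R_N(Θ) = inf_p̂ sup_{θ ∈ Θ} ρ(θ, p̂)`. -/
def minimaxRisk {n : ℕ} (r : ℝ≥0) (Θ : Set (Fin n → ℝ)) : ℝ≥0∞ :=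
  ⨅ p : PredictiveDensity n, ⨆ θ ∈ Θ, risk r θ p

/-- The sparse parameter space `Θ_n[s] = {θ ∈ ℝⁿ : #{i : θ i ≠ 0} ≤ s}`. -/
def sparseSet (n : ℕ) (s : ℝ) : Set (Fin n → ℝ) :=
  {θ | (hammingNorm θ : ℝ) ≤ s}

/-- The univariate two point prior `π[η, l] = (1 - η) δ_0 + η δ_l` (for `0 ≤ η ≤ 1`). -/
def twoPointPrior (η l : ℝ) : Measure ℝ :=
  ENNReal.ofReal (1 - η) • Measure.dirac 0 + ENNReal.ofReal η • Measure.dirac l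

/-- The oracle variance `v_w = (1 + r⁻¹)⁻¹`. -/
def oracleVar (r : ℝ≥0) : ℝ := (1 + (r : ℝ)⁻¹)⁻¹

/-- The threshold `λ_e = √(2 log (η⁻¹ (1 - η)))`. -/
def lambdaE (η : ℝ) : ℝ := √(2 * Real.log (η⁻¹ * (1 - η)))

/-- The scaled threshold `λ_f = √v_w λ_e`. -/
def lambdaF (r : ℝ≥0) (η : ℝ) : ℝ := √(oracleVar r) * lambdaE η

/-- The i.i.d. sparse prior on `ℝⁿ`: the `n`-fold product of `π[η, λ_f(η)]`. -/
def iidPrior (n : ℕ) (r : ℝ≥0) (η : ℝ) : Measure (Fin n → ℝ) :=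
  Measure.pi fun _ => twoPointPrior η (lambdaF r η)

end

end SparsePrediction

namespace SparsePrediction

/-! ### Measure-theoretic tools -/

/-! Write η = s/n = exp(-k²/2), so that k → ∞. Both risks are shown to be s·k²/(2(1+r))·(1+o(1)),
whence their ratio tends to 1.

Upper bound. One estimator serves both risks: a product of univariate mixtures of N(0,r) and
N(x,1+r). This is the Bayes rule for an atom at 0 plus a flat component of relative weight of order
η, since N(x,1+r) is the predictive density under the flat prior. A zero coordinate costs at most
6kη (`exists_mixLoss_zero_bound`), so n of them cost O(ks) = o(k²s). A nonzero coordinate costs at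
most k²/(2(1+r)) + k + O(1), uniformly in its value (`exists_mixLoss_bound`).

Lower bound. The Bayes rule is never computed. For every estimator and every suitable test function
g, KL(P‖Q) ≥ 1 + ∫ g dP - ∫ e^g dQ. Take g to be the sum over coordinates of log [p(y|θ) /
(p(y|0)(1+t))], with t the posterior odds of the spike given (x,y). Up to a factor depending on x
alone, the denominator is the Bayes predictive density, so averaging e^g over the prior and X
cancels it: the exponential term is at most 1 for all estimators at once
(`lintegral_expMoment_le_one`). A spike at l contributes l²/(2r) - O(l+1) to ∫ g dP, and l = λ_f
gives l²/(2r) = λ_e²/(2(1+r)); a zero contributes at least minus the prior odds.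

For the minimax risk the same inequality is integrated only over the sparse set, under the prior
with sparsity (1-δ)η. A variance bound shows that few expected spikes are lost outside the set
(`le_setIntegral_hammingNorm`), and δ = s^(-1/4) makes all losses negligible. -/

theorem lintegral_pi_prod {n : ℕ} {E : Fin n → Type*} [∀ i, MeasurableSpace (E i)]
    (μ : (i : Fin n) → Measure (E i)) [∀ i, SigmaFinite (μ i)]
    (f : (i : Fin n) → E i → ℝ≥0∞) (hf : ∀ i, Measurable (f i)) :
    ∫⁻ x, ∏ i, f i (x i) ∂(Measure.pi μ) = ∏ i, ∫⁻ x, f i x ∂(μ i) := by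
  induction n with
  | zero => simp
  | succ n ih =>
    rw [← ((measurePreserving_piFinSuccAbove μ 0).symm).lintegral_comp_emb
      (MeasurableEquiv.measurableEmbedding _)]
    have h : ∀ x : E 0 × ((i : Fin n) → E (Fin.succ i)),
        ∏ i, f i ((MeasurableEquiv.piFinSuccAbove E 0).symm x i) =
          f 0 x.1 * ∏ i : Fin n, f (Fin.succ i) (x.2 i) := by
      intro x
      rw [Fin.prod_univ_succ]
      rfl
    have h2 := lintegral_prod_mul (μ := μ 0) (ν := Measure.pi fun i : Fin n ↦ μ i.succ)
      (hf 0).aemeasurable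
      (g := fun x => ∏ i : Fin n, f (Fin.succ i) (x i))
      (Finset.measurable_prod _ fun i _ =>
        (hf i.succ).comp (measurable_pi_apply i)).aemeasurable
    rw [Fin.prod_univ_succ, ← ih (fun i => μ i.succ) (fun i => f i.succ) fun i => hf i.succ, ← h2]
    exact lintegral_congr h

theorem pi_withDensity {n : ℕ} (f : Fin n → ℝ → ℝ≥0∞) (hf : ∀ i, Measurable (f i))
    [∀ i, SigmaFinite ((volume : Measure ℝ).withDensity (f i))] :
    Measure.pi (fun i => (volume : Measure ℝ).withDensity (f i)) =
      (volume : Measure (Fin n → ℝ)).withDensity fun x => ∏ i, f i (x i) := by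
  refine Measure.pi_eq fun s hs => ?_
  rw [withDensity_apply _ (MeasurableSet.univ_pi hs),
    ← lintegral_indicator (MeasurableSet.univ_pi hs)]
  have h : ∀ x : Fin n → ℝ, (Set.univ.pi s).indicator (fun x => ∏ i, f i (x i)) x =
      ∏ i, (s i).indicator (f i) (x i) := by
    intro x
    by_cases hx : x ∈ Set.univ.pi s
    · rw [Set.indicator_of_mem hx]
      exact Finset.prod_congr rfl fun i _ => (Set.indicator_of_mem (hx i trivial) _).symm
    · rw [Set.indicator_of_notMem hx]
      simp only [Set.mem_pi, Set.mem_univ, true_implies, not_forall] at hx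
      obtain ⟨i, hi⟩ := hx
      exact (Finset.prod_eq_zero (Finset.mem_univ i) (Set.indicator_of_notMem hi _)).symm
  rw [lintegral_congr h, volume_pi, lintegral_pi_prod _ _ fun i => (hf i).indicator (hs i)]
  refine Finset.prod_congr rfl fun i _ => ?_
  rw [withDensity_apply _ (hs i), lintegral_indicator (hs i)]

theorem normalVec_eq_withDensity {n : ℕ} (θ : Fin n → ℝ) {v : ℝ≥0} (hv : v ≠ 0) :
    normalVec θ v = volume.withDensity fun x => ∏ i, gaussianPDF (θ i) v (x i) := by
  have h : ∀ i, gaussianReal (θ i) v = volume.withDensity (gaussianPDF (θ i) v) := fun i =>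
    gaussianReal_of_var_ne_zero _ hv
  have : ∀ i, SigmaFinite ((volume : Measure ℝ).withDensity (gaussianPDF (θ i) v)) := fun i => by
    rw [← h i]; infer_instance
  rw [normalVec, ← pi_withDensity _ fun i => measurable_gaussianPDF _ _]
  simp_rw [h]

instance {n : ℕ} (θ : Fin n → ℝ) (v : ℝ≥0) : IsProbabilityMeasure (normalVec θ v) := by
  unfold normalVec; infer_instance

theorem PredictiveDensity.measurable_right {n : ℕ} (p : PredictiveDensity n) (x : Fin n → ℝ) :
    Measurable (p.dens x) :=
  p.measurable_dens.comp measurable_prodMk_left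

instance {n : ℕ} (p : PredictiveDensity n) (x : Fin n → ℝ) : IsProbabilityMeasure (p.law x) := by
  constructor
  rw [PredictiveDensity.law, withDensity_apply _ MeasurableSet.univ, Measure.restrict_univ]
  exact p.lintegral_dens x

/-- A non-integrable `f` has Bochner integral 0, so no hypothesis is needed. This later allows
integration of bounds on the risk without checking integrability. -/
theorem ofReal_integral_le_lintegral {α : Type*} [MeasurableSpace α] {μ : Measure α} (f : α → ℝ) :
    ENNReal.ofReal (∫ x, f x ∂μ) ≤ ∫⁻ x, ENNReal.ofReal (f x) ∂μ := by
  by_cases hf : Integrable f μ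
  · rw [integral_eq_lintegral_pos_part_sub_lintegral_neg_part hf]
    refine (ENNReal.ofReal_le_ofReal (sub_le_self _ ENNReal.toReal_nonneg)).trans ?_
    exact ENNReal.ofReal_toReal_le
  · simp [integral_undef hf]

/-- The Kullback–Leibler divergence between two measures given by positive densities. -/
theorem klDiv_withDensity_of_pos {α : Type*} [MeasurableSpace α] {μ : Measure α} {f q : α → ℝ}
    (hf : Measurable f) (hq : Measurable q) (hf0 : ∀ x, 0 < f x) (hq0 : ∀ x, 0 < q x)
    [IsProbabilityMeasure (μ.withDensity fun x => ENNReal.ofReal (f x))]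
    [IsProbabilityMeasure (μ.withDensity fun x => ENNReal.ofReal (q x))]
    (hint : Integrable (fun x => Real.log (f x) - Real.log (q x))
      (μ.withDensity fun x => ENNReal.ofReal (f x))) :
    0 ≤ ∫ x, (Real.log (f x) - Real.log (q x)) ∂(μ.withDensity fun x => ENNReal.ofReal (f x)) ∧
    InformationTheory.klDiv (μ.withDensity fun x => ENNReal.ofReal (f x))
        (μ.withDensity fun x => ENNReal.ofReal (q x)) =
      ENNReal.ofReal (∫ x, (Real.log (f x) - Real.log (q x))
        ∂(μ.withDensity fun x => ENNReal.ofReal (f x))) := by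
  set P := μ.withDensity fun x => ENNReal.ofReal (f x) with hP
  set Q := μ.withDensity fun x => ENNReal.ofReal (q x) with hQ
  have hPQ : P = Q.withDensity fun x => ENNReal.ofReal (f x / q x) := by
    have hfq : Measurable fun x => ENNReal.ofReal (f x / q x) := (hf.div hq).ennreal_ofReal
    rw [hQ, ← withDensity_mul _ hq.ennreal_ofReal hfq, hP]
    congr 1
    ext x
    rw [Pi.mul_apply, ← ENNReal.ofReal_mul (hq0 x).le, mul_div_cancel₀ _ (hq0 x).ne']
  have hac : P ≪ Q := by rw [hPQ]; exact withDensity_absolutelyContinuous _ _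
  have hrn : P.rnDeriv Q =ᵐ[Q] fun x => ENNReal.ofReal (f x / q x) := by
    rw [hPQ]; exact Measure.rnDeriv_withDensity _ (hf.div hq).ennreal_ofReal
  have hllr : llr P Q =ᵐ[P] fun x => Real.log (f x) - Real.log (q x) := by
    filter_upwards [hac.ae_le hrn] with x hx
    rw [llr, hx, ENNReal.toReal_ofReal (div_pos (hf0 x) (hq0 x)).le,
      Real.log_div (hf0 x).ne' (hq0 x).ne']
  have hint' : Integrable (llr P Q) P := (integrable_congr hllr).mpr hint
  have h1 := InformationTheory.integral_llr_add_sub_measure_univ_nonneg hac hint'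
  have h2 := InformationTheory.klDiv_of_ac_of_integrable hac hint'
  rw [integral_congr_ae hllr] at h1 h2
  simp only [probReal_univ, add_sub_cancel_right] at h1 h2
  exact ⟨h1, h2⟩

/-- A weak form of the Donsker–Varadhan inequality. -/
theorem ofReal_one_add_integral_le_klDiv_add {α : Type*} [MeasurableSpace α] (P Q : Measure α)
    [IsProbabilityMeasure P] [IsProbabilityMeasure Q] {g : α → ℝ} (hg : Measurable g)
    (hint : Integrable g P) :
    ENNReal.ofReal (1 + ∫ x, g x ∂P) ≤
      InformationTheory.klDiv P Q + ∫⁻ x, ENNReal.ofReal (Real.exp (g x)) ∂Q := by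
  by_cases hac : P ≪ Q
  swap
  · simp [InformationTheory.klDiv_of_not_ac hac]
  have hexp : Measurable fun x => ENNReal.ofReal (Real.exp (g x)) :=
    (Real.measurable_exp.comp hg).ennreal_ofReal
  rw [InformationTheory.klDiv_eq_lintegral_klFun_of_ac hac, ← lintegral_add_right _ hexp]
  have hint' : Integrable (fun x => (P.rnDeriv Q x).toReal • g x) Q :=
    (integrable_rnDeriv_smul_iff hac).mpr hint
  have h1 : 1 + ∫ x, g x ∂P = ∫ x, (1 + (P.rnDeriv Q x).toReal • g x) ∂Q := by
    rw [integral_add (integrable_const _) hint', integral_rnDeriv_smul hac]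
    simp
  rw [h1]
  refine (ofReal_integral_le_lintegral _).trans (lintegral_mono fun x => ?_)
  set z := (P.rnDeriv Q x).toReal
  have hz : 0 ≤ z := ENNReal.toReal_nonneg
  rw [← ENNReal.ofReal_add (InformationTheory.klFun_nonneg hz) (Real.exp_pos _).le]
  refine ENNReal.ofReal_le_ofReal ?_
  -- What remains is the Fenchel–Young inequality z·g ≤ z log z - z + e^g; for z > 0 it is 1 + w ≤
  -- e^w at w = g - log z.
  rw [InformationTheory.klFun_apply, smul_eq_mul]
  rcases hz.eq_or_lt with h0 | h0
  · rw [← h0]; simp [(Real.exp_pos (g x)).le]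
  · have h2 := Real.add_one_le_exp (g x - Real.log z)
    rw [Real.exp_sub, Real.exp_log h0, le_div_iff₀ h0] at h2
    nlinarith

/-! ### Gaussian moments and log-densities -/

theorem integrable_id_gaussianReal (θ : ℝ) (v : ℝ≥0) : Integrable (fun x => x) (gaussianReal θ v) :=
  (memLp_id_gaussianReal' (μ := θ) (v := v) 1 (by simp)).integrable le_rfl

theorem integrable_sub_sq_gaussianReal (θ c : ℝ) (v : ℝ≥0) :
    Integrable (fun x => (x - c) ^ 2) (gaussianReal θ v) :=
  ((memLp_id_gaussianReal' (μ := θ) (v := v) 2 (by simp)).sub (memLp_const c)).integrable_sq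

theorem integrable_sq_gaussianReal (θ : ℝ) (v : ℝ≥0) :
    Integrable (fun x => x ^ 2) (gaussianReal θ v) := by
  simpa using integrable_sub_sq_gaussianReal θ 0 v

theorem integral_sub_sq_gaussianReal (θ c : ℝ) (v : ℝ≥0) :
    ∫ x, (x - c) ^ 2 ∂(gaussianReal θ v) = v + (θ - c) ^ 2 := by
  have h1 : ∫ x, (x - θ) ^ 2 ∂(gaussianReal θ v) = v := by
    have h := variance_eq_integral (μ := gaussianReal θ v) (X := fun x => x) (by fun_prop)
    rw [variance_fun_id_gaussianReal, integral_id_gaussianReal] at h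
    exact h.symm
  have h2 : ∀ x : ℝ, (x - c) ^ 2 = (x - θ) ^ 2 + (2 * (θ - c) * x + ((θ - c) ^ 2 - 2 * (θ - c) * θ)) := by
    intro x; ring
  rw [integral_congr_ae (Eventually.of_forall h2)]
  refine (integral_add (integrable_sub_sq_gaussianReal θ θ v)
    (((integrable_id_gaussianReal θ v).const_mul _).add (integrable_const _))).trans ?_
  simp only [Pi.add_apply]
  rw [integral_add ((integrable_id_gaussianReal θ v).const_mul _) (integrable_const _),
    integral_const_mul, integral_id_gaussianReal, h1]
  simp

theorem integral_sq_gaussianReal (θ : ℝ) (v : ℝ≥0) :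
    ∫ x, x ^ 2 ∂(gaussianReal θ v) = v + θ ^ 2 := by
  simpa using integral_sub_sq_gaussianReal θ 0 v

theorem log_gaussianPDFReal (c : ℝ) {v : ℝ≥0} (hv : v ≠ 0) (y : ℝ) :
    Real.log (gaussianPDFReal c v y) =
      -(Real.log (2 * Real.pi * v) / 2) - (y - c) ^ 2 / (2 * v) := by
  have hv' : (0 : ℝ) < v := by positivity
  rw [gaussianPDFReal, Real.log_mul (by positivity) (Real.exp_pos _).ne', Real.log_exp,
    Real.log_inv, Real.log_sqrt (by positivity)]
  ring

theorem integrable_log_gaussianPDFReal (θ c : ℝ) (v' : ℝ≥0) {v : ℝ≥0} (hv : v ≠ 0) :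
    Integrable (fun y => Real.log (gaussianPDFReal c v y)) (gaussianReal θ v') := by
  simp_rw [log_gaussianPDFReal c hv]
  exact (integrable_const _).sub ((integrable_sub_sq_gaussianReal θ c v').div_const _)

/-- The Kullback–Leibler divergence between two Gaussian laws. -/
theorem integral_log_gaussianPDFReal_sub (θ c : ℝ) {r v : ℝ≥0} (hr : r ≠ 0) (hv : v ≠ 0) :
    ∫ y, (Real.log (gaussianPDFReal θ r y) - Real.log (gaussianPDFReal c v y)) ∂(gaussianReal θ r) =
      Real.log (v / r) / 2 + (r + (θ - c) ^ 2) / (2 * v) - 1 / 2 := by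
  have hr' : (0 : ℝ) < r := by positivity
  have hv' : (0 : ℝ) < v := by positivity
  rw [integral_sub (integrable_log_gaussianPDFReal θ θ r hr) (integrable_log_gaussianPDFReal θ c r hv)]
  simp_rw [log_gaussianPDFReal _ hr, log_gaussianPDFReal _ hv]
  rw [integral_sub (integrable_const _) ((integrable_sub_sq_gaussianReal θ θ r).div_const _),
    integral_sub (integrable_const _) ((integrable_sub_sq_gaussianReal θ c r).div_const _),
    integral_div, integral_div, integral_sub_sq_gaussianReal, integral_sub_sq_gaussianReal,
    Real.log_div hv'.ne' hr'.ne', Real.log_mul (by positivity) hr'.ne',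
    Real.log_mul (by positivity) hv'.ne']
  simp
  field_simp
  ring

/-! ### The univariate estimator -/

/-- The predictive density that mixes `N(0, r)` and `N(x, 1 + r)` with weights proportional to
`exp (-x² / 2)` and `κ`. -/
noncomputable def mixDens (r : ℝ≥0) (κ x y : ℝ) : ℝ :=
  (Real.exp (-x ^ 2 / 2) * gaussianPDFReal 0 r y + κ * gaussianPDFReal x (1 + r) y) /
    (Real.exp (-x ^ 2 / 2) + κ)

section mixDens

variable {r : ℝ≥0} {κ : ℝ}

theorem measurable_mixDens {α : Type*} [MeasurableSpace α] {f g : α → ℝ} (hf : Measurable f)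
    (hg : Measurable g) : Measurable fun a => mixDens r κ (f a) (g a) := by
  have h1 : Measurable fun a => gaussianPDFReal 0 r (g a) :=
    (measurable_gaussianPDFReal 0 r).comp hg
  have h2 : Measurable fun a => gaussianPDFReal (f a) (1 + r) (g a) :=
    measurable_uncurry_gaussianPDFReal.comp (hf.prodMk (measurable_const.prodMk hg))
  unfold mixDens
  fun_prop

theorem mixDens_pos (hr : r ≠ 0) (hκ : 0 < κ) (x y : ℝ) : 0 < mixDens r κ x y := by
  have h1 := gaussianPDFReal_pos 0 r y hr
  have h2 := gaussianPDFReal_pos x (1 + r) y (by positivity)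
  unfold mixDens
  positivity

theorem lintegral_mixDens (hr : r ≠ 0) (hκ : 0 < κ) (x : ℝ) :
    ∫⁻ y, ENNReal.ofReal (mixDens r κ x y) = 1 := by
  have hr1 : 1 + r ≠ 0 := by positivity
  have hi : Integrable (fun y => mixDens r κ x y) :=
    (((integrable_gaussianPDFReal 0 r).const_mul _).add
      ((integrable_gaussianPDFReal x (1 + r)).const_mul _)).div_const _
  rw [← ofReal_integral_eq_lintegral_ofReal hi
    (Eventually.of_forall fun y => (mixDens_pos hr hκ x y).le)]
  unfold mixDens
  rw [integral_div, integral_add ((integrable_gaussianPDFReal 0 r).const_mul _)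
      ((integrable_gaussianPDFReal x (1 + r)).const_mul _), integral_const_mul, integral_const_mul,
    integral_gaussianPDFReal_eq_one _ hr, integral_gaussianPDFReal_eq_one _ hr1]
  have : 0 < Real.exp (-x ^ 2 / 2) + κ := by positivity
  rw [mul_one, mul_one, div_self this.ne', ENNReal.ofReal_one]

/-- Only one summand of the numerator is kept; `le_log_mixDens_slab` keeps the other. -/
theorem le_log_mixDens_zero (hr : r ≠ 0) (hκ : 0 < κ) (x y : ℝ) :
    -x ^ 2 / 2 + Real.log (gaussianPDFReal 0 r y) - Real.log (Real.exp (-x ^ 2 / 2) + κ) ≤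
      Real.log (mixDens r κ x y) := by
  have h1 := gaussianPDFReal_pos 0 r y hr
  have h2 := gaussianPDFReal_pos x (1 + r) y (by positivity)
  have h3 := Real.exp_pos (-x ^ 2 / 2)
  rw [mixDens, Real.log_div (by positivity) (by positivity)]
  have h4 : Real.log (Real.exp (-x ^ 2 / 2) * gaussianPDFReal 0 r y) ≤
      Real.log (Real.exp (-x ^ 2 / 2) * gaussianPDFReal 0 r y +
        κ * gaussianPDFReal x (1 + r) y) :=
    Real.log_le_log (by positivity) (by nlinarith [mul_pos hκ h2])
  rw [Real.log_mul h3.ne' h1.ne', Real.log_exp] at h4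
  linarith

theorem le_log_mixDens_slab (hr : r ≠ 0) (hκ : 0 < κ) (x y : ℝ) :
    Real.log κ + Real.log (gaussianPDFReal x (1 + r) y) - Real.log (Real.exp (-x ^ 2 / 2) + κ) ≤
      Real.log (mixDens r κ x y) := by
  have h1 := gaussianPDFReal_pos 0 r y hr
  have h2 := gaussianPDFReal_pos x (1 + r) y (by positivity)
  have h3 := Real.exp_pos (-x ^ 2 / 2)
  rw [mixDens, Real.log_div (by positivity) (by positivity)]
  have h4 : Real.log (κ * gaussianPDFReal x (1 + r) y) ≤
      Real.log (Real.exp (-x ^ 2 / 2) * gaussianPDFReal 0 r y +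
        κ * gaussianPDFReal x (1 + r) y) :=
    Real.log_le_log (by positivity) (by nlinarith [mul_pos h3 h1])
  rw [Real.log_mul hκ.ne' h2.ne'] at h4
  linarith

theorem gaussianPDFReal_le (c : ℝ) (v : ℝ≥0) (y : ℝ) :
    gaussianPDFReal c v y ≤ (√(2 * Real.pi * v))⁻¹ := by
  rw [gaussianPDFReal]
  refine mul_le_of_le_one_right (by positivity) (Real.exp_le_one_iff.mpr ?_)
  have : 0 ≤ (y - c) ^ 2 / (2 * (v : ℝ)) := by positivity
  rw [neg_div]
  linarith

/-- With `le_log_mixDens_zero` this sandwiches log `mixDens` between integrable functions of y. -/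
theorem mixDens_le (hκ : 0 < κ) (x y : ℝ) :
    mixDens r κ x y ≤ (√(2 * Real.pi * r))⁻¹ + (√(2 * Real.pi * (1 + r : ℝ≥0)))⁻¹ := by
  have h1 := gaussianPDFReal_le 0 r y
  have h2 := gaussianPDFReal_le x (1 + r) y
  have h3 := Real.exp_pos (-x ^ 2 / 2)
  have h4 : 0 ≤ (√(2 * Real.pi * r))⁻¹ := by positivity
  have h5 : 0 ≤ (√(2 * Real.pi * (1 + r : ℝ≥0)))⁻¹ := by positivity
  rw [mixDens, div_le_iff₀ (by positivity)]
  nlinarith [mul_le_mul_of_nonneg_left h1 h3.le, mul_le_mul_of_nonneg_left h2 hκ.le,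
    mul_nonneg h3.le h5, mul_nonneg hκ.le h4]

/-- The univariate Kullback–Leibler loss of `mixDens`. -/
noncomputable def mixLoss (r : ℝ≥0) (κ θ x : ℝ) : ℝ :=
  ∫ y, (Real.log (gaussianPDFReal θ r y) - Real.log (mixDens r κ x y)) ∂(gaussianReal θ r)

theorem integrable_mixLoss (hr : r ≠ 0) (hκ : 0 < κ) (θ x : ℝ) :
    Integrable (fun y => Real.log (gaussianPDFReal θ r y) - Real.log (mixDens r κ x y))
      (gaussianReal θ r) := by
  refine (integrable_log_gaussianPDFReal θ θ r hr).sub ?_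
  refine integrable_of_le_of_le ?_ (Eventually.of_forall fun y => le_log_mixDens_zero hr hκ x y)
    (Eventually.of_forall fun y => Real.log_le_log (mixDens_pos hr hκ x y) (mixDens_le hκ x y))
    (((integrable_const _).add (integrable_log_gaussianPDFReal θ 0 r hr)).sub (integrable_const _))
    (integrable_const _)
  exact (Real.measurable_log.comp (measurable_mixDens measurable_const measurable_id)).aestronglyMeasurable

/-- At θ = 0 one component is the true density, so the log-ratio never exceeds minus the log of its
weight, whatever y is. -/
theorem mixLoss_zero_le (hr : r ≠ 0) (hκ : 0 < κ) (x : ℝ) :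
    mixLoss r κ 0 x ≤ Real.log (1 + κ * Real.exp (x ^ 2 / 2)) := by
  have h : ∀ y, Real.log (gaussianPDFReal 0 r y) - Real.log (mixDens r κ x y) ≤
      Real.log (1 + κ * Real.exp (x ^ 2 / 2)) := by
    intro y
    have h1 := le_log_mixDens_zero hr hκ x y
    have h2 : Real.exp (-x ^ 2 / 2) + κ =
        Real.exp (-x ^ 2 / 2) * (1 + κ * Real.exp (x ^ 2 / 2)) := by
      have : Real.exp (-x ^ 2 / 2) * Real.exp (x ^ 2 / 2) = 1 := by
        rw [← Real.exp_add, ← Real.exp_zero]; congr 1; ring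
      linear_combination -κ * this
    rw [h2, Real.log_mul (Real.exp_pos _).ne' (by positivity), Real.log_exp] at h1
    linarith
  refine (integral_mono (integrable_mixLoss hr hκ 0 x) (integrable_const _) h).trans ?_
  simp

/-- Both one-component bounds hold, hence so does every convex combination of them; the weight u is
left free to be adapted to θ. -/
theorem mixLoss_le (hr : r ≠ 0) (hκ : 0 < κ) (θ x : ℝ) {u : ℝ} (hu0 : 0 ≤ u) (hu1 : u ≤ 1) :
    mixLoss r κ θ x ≤ Real.log (Real.exp (-x ^ 2 / 2) + κ) + u * (x ^ 2 / 2 + θ ^ 2 / (2 * r)) +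
      (1 - u) * (-Real.log κ + (Real.log ((1 + r) / r) / 2 +
        (r + (θ - x) ^ 2) / (2 * (1 + r)) - 1 / 2)) := by
  have hr1 : 1 + r ≠ 0 := by positivity
  have hr' : (0 : ℝ) < r := by positivity
  have i1 : Integrable (fun y => u * (Real.log (gaussianPDFReal θ r y) -
      Real.log (gaussianPDFReal 0 r y))) (gaussianReal θ r) :=
    ((integrable_log_gaussianPDFReal θ θ r hr).sub
      (integrable_log_gaussianPDFReal θ 0 r hr)).const_mul u
  have i2 : Integrable (fun y => (1 - u) * (Real.log (gaussianPDFReal θ r y) -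
      Real.log (gaussianPDFReal x (1 + r) y))) (gaussianReal θ r) :=
    ((integrable_log_gaussianPDFReal θ θ r hr).sub
      (integrable_log_gaussianPDFReal θ x r hr1)).const_mul (1 - u)
  have h : ∀ y, Real.log (gaussianPDFReal θ r y) - Real.log (mixDens r κ x y) ≤
      (Real.log (Real.exp (-x ^ 2 / 2) + κ) + u * (x ^ 2 / 2) + (1 - u) * (-Real.log κ)) +
      (u * (Real.log (gaussianPDFReal θ r y) - Real.log (gaussianPDFReal 0 r y)) +
      (1 - u) * (Real.log (gaussianPDFReal θ r y) - Real.log (gaussianPDFReal x (1 + r) y))) := by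
    intro y
    have h1 := mul_le_mul_of_nonneg_left (le_log_mixDens_zero hr hκ x y) hu0
    have h2 := mul_le_mul_of_nonneg_left (le_log_mixDens_slab hr hκ x y) (sub_nonneg.mpr hu1)
    linarith
  refine (integral_mono (integrable_mixLoss hr hκ θ x)
    ((integrable_const _).add (i1.add i2)) h).trans ?_
  refine (integral_add (integrable_const _) (i1.add i2)).trans_le ?_
  simp only [Pi.add_apply]
  rw [integral_add i1 i2]
  rw [integral_const_mul, integral_const_mul, integral_log_gaussianPDFReal_sub θ 0 hr hr,
    integral_log_gaussianPDFReal_sub θ x hr hr1, div_self hr'.ne', Real.log_one]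
  simp only [integral_const, probReal_univ, smul_eq_mul, one_mul, NNReal.coe_add, NNReal.coe_one]
  refine le_of_eq ?_
  field_simp
  ring

/-- `x ↦ min (x² / 2) (k² / 2)` is `k`-Lipschitz. -/
theorem min_sq_sub_le {k : ℝ} (hk : 0 ≤ k) (x θ : ℝ) :
    min (θ ^ 2 / 2) (k ^ 2 / 2) - k * |x - θ| ≤ min (x ^ 2 / 2) (k ^ 2 / 2) := by
  have h1 : |θ| ≤ |x| + |x - θ| := by
    have := abs_sub_abs_le_abs_sub θ x
    rw [abs_sub_comm θ x] at this; linarith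
  rcases le_total |x| k with hx | hx
  · rw [min_eq_left (a := x ^ 2 / 2) (by rw [← sq_abs x]; gcongr)]
    rcases le_total |θ| k with ht | ht
    · refine (sub_le_sub_right (min_le_left _ _) _).trans ?_
      rw [← sq_abs x, ← sq_abs θ]
      nlinarith [abs_nonneg x, abs_nonneg θ, abs_nonneg (x - θ)]
    · refine (sub_le_sub_right (min_le_right _ _) _).trans ?_
      rw [← sq_abs x]
      nlinarith [abs_nonneg x, abs_nonneg θ, abs_nonneg (x - θ)]
  · rw [min_eq_right (a := x ^ 2 / 2) (by rw [← sq_abs x]; gcongr)]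
    have := min_le_right (θ ^ 2 / 2) (k ^ 2 / 2)
    nlinarith [abs_nonneg (x - θ), mul_nonneg hk (abs_nonneg (x - θ))]

/-- The normaliser of the mixture is at most twice its larger term: it decays like exp(-x²/2) until
|x| reaches k and is then constant. -/
theorem log_exp_add_exp_le {k : ℝ} (x : ℝ) :
    Real.log (Real.exp (-x ^ 2 / 2) + Real.exp (-(k ^ 2 / 2))) ≤
      Real.log 2 - min (x ^ 2 / 2) (k ^ 2 / 2) := by
  set m := min (x ^ 2 / 2) (k ^ 2 / 2)
  have h1 : Real.exp (-x ^ 2 / 2) ≤ Real.exp (-m) :=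
    Real.exp_le_exp.mpr (by have := min_le_left (x ^ 2 / 2) (k ^ 2 / 2); linarith)
  have h2 : Real.exp (-(k ^ 2 / 2)) ≤ Real.exp (-m) :=
    Real.exp_le_exp.mpr (by have := min_le_right (x ^ 2 / 2) (k ^ 2 / 2); linarith)
  calc _ ≤ Real.log (2 * Real.exp (-m)) := Real.log_le_log (by positivity) (by linarith)
    _ = _ := by rw [Real.log_mul (by norm_num) (Real.exp_pos _).ne', Real.log_exp]; ring

/-- The uniform bound on the univariate risk of `mixDens` when `κ = exp (-k² / 2)`. -/
noncomputable def slabBound (r : ℝ≥0) (k : ℝ) : ℝ :=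
  k ^ 2 / 2 / (1 + r) + k + 2 + Real.log ((1 + r) / r) / 2

theorem slabBound_nonneg (hr : r ≠ 0) {k : ℝ} (hk : 0 ≤ k) : 0 ≤ slabBound r k := by
  have hr' : (0 : ℝ) < r := by positivity
  have : 0 ≤ Real.log ((1 + r) / r) := Real.log_nonneg (by rw [le_div_iff₀ hr']; linarith)
  unfold slabBound
  positivity

/-- The Lipschitz bound replaces min(x²,k²)/2 by min(θ²,k²)/2 at mean cost at most k; the convex
weight u then depends on which side of k the size |θ| lies. An explicit majorant avoids discussing
`mixLoss` as a function of x. -/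
theorem exists_mixLoss_bound (hr : r ≠ 0) {k : ℝ} (hk : 0 ≤ k) (θ : ℝ) :
    ∃ b : ℝ → ℝ, Integrable b (gaussianReal θ 1) ∧
      (∀ x, mixLoss r (Real.exp (-(k ^ 2 / 2))) θ x ≤ b x) ∧
      ∫ x, b x ∂(gaussianReal θ 1) ≤ slabBound r k := by
  have hr' : (0 : ℝ) < r := by positivity
  have hC : 0 ≤ Real.log ((1 + r) / r) := Real.log_nonneg (by rw [le_div_iff₀ hr']; linarith)
  have hlog2 : Real.log 2 ≤ 1 := by
    have := Real.log_le_sub_one_of_pos (x := 2) (by norm_num); linarith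
  have key : ∀ u : ℝ, 0 ≤ u → u ≤ 1 → ∃ b : ℝ → ℝ, Integrable b (gaussianReal θ 1) ∧
      (∀ x, mixLoss r (Real.exp (-(k ^ 2 / 2))) θ x ≤ b x) ∧
      ∫ x, b x ∂(gaussianReal θ 1) = Real.log 2 - min (θ ^ 2 / 2) (k ^ 2 / 2) + k +
        u * ((1 + θ ^ 2) / 2 + θ ^ 2 / (2 * r)) +
        (1 - u) * (k ^ 2 / 2 + Real.log ((1 + r) / r) / 2) := by
    intro u hu0 hu1
    refine ⟨fun x => (Real.log 2 - min (θ ^ 2 / 2) (k ^ 2 / 2) + k / 2 + u * (θ ^ 2 / (2 * r)) +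
      (1 - u) * (k ^ 2 / 2 + (Real.log ((1 + r) / r) / 2 + r / (2 * (1 + r)) - 1 / 2))) +
      ((k / 2 + (1 - u) / (2 * (1 + r))) * (x - θ) ^ 2 + u / 2 * x ^ 2), ?_, fun x => ?_, ?_⟩
    · exact (integrable_const _).add (((integrable_sub_sq_gaussianReal θ θ 1).const_mul _).add
        ((integrable_sq_gaussianReal θ 1).const_mul _))
    · refine (mixLoss_le hr (Real.exp_pos _) θ x hu0 hu1).trans ?_
      have h1 := log_exp_add_exp_le (k := k) x
      have h2 := min_sq_sub_le hk x θ
      -- A quadratic majorant makes the mean explicit: E(x-θ)² = 1, so the right side has mean k.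
      have h3 : k * |x - θ| ≤ k * ((1 + (x - θ) ^ 2) / 2) :=
        mul_le_mul_of_nonneg_left (by nlinarith [sq_abs (x - θ), sq_nonneg (|x - θ| - 1)]) hk
      rw [Real.log_exp]
      have h4 : (r + (θ - x) ^ 2) / (2 * (1 + r : ℝ)) =
        r / (2 * (1 + r)) + 1 / (2 * (1 + r)) * (x - θ) ^ 2 := by ring
      rw [h4, div_eq_mul_one_div (1 - u)]
      linarith
    · refine (integral_add (integrable_const _)
        (((integrable_sub_sq_gaussianReal θ θ 1).const_mul _).add
        ((integrable_sq_gaussianReal θ 1).const_mul _))).trans ?_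
      simp only [Pi.add_apply]
      rw [integral_add ((integrable_sub_sq_gaussianReal θ θ 1).const_mul _)
        ((integrable_sq_gaussianReal θ 1).const_mul _), integral_const_mul, integral_const_mul,
        integral_sub_sq_gaussianReal, integral_sq_gaussianReal]
      simp only [integral_const, probReal_univ, smul_eq_mul, one_mul, NNReal.coe_one]
      field_simp
      ring
  rcases le_total (k ^ 2 / 2) (θ ^ 2 / 2) with h | h
  -- For |θ| ≥ k the flat component alone suffices: its cost k²/2 is cancelled by the normaliser.
  · obtain ⟨b, h1, h2, h3⟩ := key 0 le_rfl zero_le_one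
    refine ⟨b, h1, h2, h3.trans_le ?_⟩
    rw [min_eq_right h, slabBound]
    have : 0 ≤ k ^ 2 / 2 / (1 + (r : ℝ)) := by positivity
    linarith
  · have hw1 : r / (1 + r) ≤ (1 : ℝ) := by rw [div_le_one (by positivity)]; linarith
    have hw0 : 0 ≤ r / (1 + r : ℝ) := by positivity
    -- With u = r/(1+r), u(θ²/2 + θ²/(2r)) = θ²/2 cancels the normaliser, and (1-u)k²/2 is the
    -- leading term.
    obtain ⟨b, h1, h2, h3⟩ := key (r / (1 + r)) hw0 hw1
    refine ⟨b, h1, h2, h3.trans_le ?_⟩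
    rw [min_eq_left h, slabBound]
    have e1 : r / (1 + r) * ((1 + θ ^ 2) / 2 + θ ^ 2 / (2 * r)) =
        r / (1 + r) / 2 + θ ^ 2 / 2 := by field_simp; ring
    have e2 : (1 - r / (1 + r)) * (k ^ 2 / 2 + Real.log ((1 + r) / r) / 2) =
        k ^ 2 / 2 / (1 + r) + (1 - r / (1 + r)) * (Real.log ((1 + r) / r) / 2) := by
      field_simp; ring
    rw [e1, e2]
    have : (1 - r / (1 + r)) * (Real.log ((1 + r) / r) / 2) ≤ 1 * (Real.log ((1 + r) / r) / 2) :=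
      mul_le_mul_of_nonneg_right (by linarith) (by linarith)
    linarith

/-- `log (1 + t) ≤ t ^ p / p` for `0 < p ≤ 1`. -/
theorem log_one_add_le_rpow_div {t p : ℝ} (ht : 0 ≤ t) (hp0 : 0 < p) (hp1 : p ≤ 1) :
    Real.log (1 + t) ≤ t ^ p / p := by
  have h1 := Real.rpow_add_le_add_rpow zero_le_one ht hp0.le hp1
  rw [Real.one_rpow] at h1
  have h2 : p * Real.log (1 + t) ≤ t ^ p := by
    rw [← Real.log_rpow (by positivity)]
    have := Real.log_le_sub_one_of_pos (x := (1 + t) ^ p) (by positivity)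
    linarith
  rw [le_div_iff₀ hp0]; linarith

theorem integral_exp_sq_gaussianReal {a : ℝ} (ha : 0 < a) :
    Integrable (fun x => Real.exp ((1 - a) * x ^ 2 / 2)) (gaussianReal 0 1) ∧
      ∫ x, Real.exp ((1 - a) * x ^ 2 / 2) ∂(gaussianReal 0 1) = √(1 / a) := by
  have h : ∀ x : ℝ, gaussianPDFReal 0 1 x • Real.exp ((1 - a) * x ^ 2 / 2) =
      (√(2 * Real.pi))⁻¹ * Real.exp (-(a / 2) * x ^ 2) := by
    intro x
    have h' : -(x - 0) ^ 2 / (2 * ((1 : ℝ≥0) : ℝ)) + (1 - a) * x ^ 2 / 2 = -(a / 2) * x ^ 2 := by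
      rw [NNReal.coe_one]; ring
    rw [gaussianPDFReal, smul_eq_mul, mul_assoc, ← Real.exp_add, h', NNReal.coe_one, mul_one]
  constructor
  · rw [gaussianReal_of_var_ne_zero _ one_ne_zero,
      integrable_withDensity_iff_integrable_smul' (measurable_gaussianPDF 0 1)
        (Eventually.of_forall fun x => gaussianPDF_lt_top)]
    simp_rw [toReal_gaussianPDF, h]
    exact (integrable_exp_neg_mul_sq (by positivity)).const_mul _
  · rw [integral_gaussianReal_eq_integral_smul one_ne_zero]
    simp_rw [h]
    rw [integral_const_mul, integral_gaussian, ← Real.sqrt_inv, ← Real.sqrt_mul (by positivity)]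
    congr 1
    field_simp

/-- The bound log(1+t) ≤ t fails here because exp(x²/2) has infinite Gaussian mean. The power 1-a
with a = 2/k² restores integrability: the moment is 1/√a ≤ k, while κ^(1-a) = e·κ for κ =
exp(-k²/2). -/
theorem exists_mixLoss_zero_bound (hr : r ≠ 0) {k : ℝ} (hk : 2 ≤ k) :
    ∃ b : ℝ → ℝ, Integrable b (gaussianReal 0 1) ∧
      (∀ x, mixLoss r (Real.exp (-(k ^ 2 / 2))) 0 x ≤ b x) ∧
      ∫ x, b x ∂(gaussianReal 0 1) ≤ 6 * k * Real.exp (-(k ^ 2 / 2)) := by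
  set K := k ^ 2 / 2 with hK
  have hK2 : 2 ≤ K := by rw [hK]; nlinarith
  set a := 1 / K with ha
  have ha0 : 0 < a := by positivity
  have ha1 : a ≤ 1 / 2 := by rw [ha]; exact one_div_le_one_div_of_le (by norm_num) hK2
  obtain ⟨hi, hI⟩ := integral_exp_sq_gaussianReal ha0
  refine ⟨fun x => Real.exp (-K + 1) / (1 - a) * Real.exp ((1 - a) * x ^ 2 / 2), hi.const_mul _,
    fun x => ?_, ?_⟩
  · refine (mixLoss_zero_le hr (Real.exp_pos _) x).trans ?_
    refine (log_one_add_le_rpow_div (p := 1 - a) (by positivity) (by linarith)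
      (by linarith)).trans (le_of_eq ?_)
    beta_reduce
    rw [← Real.exp_add, ← Real.exp_mul, div_mul_eq_mul_div, ← Real.exp_add]
    congr 2
    have : K * a = 1 := by rw [ha]; field_simp
    linear_combination this
  · rw [integral_const_mul, hI, Real.exp_add]
    have h1 : √(1 / a) ≤ k := by
      rw [ha, one_div_one_div]
      refine Real.sqrt_le_iff.mpr ⟨by linarith, by rw [hK]; nlinarith⟩
    have h2 : Real.exp 1 / (1 - a) ≤ 6 := by
      rw [div_le_iff₀ (by linarith)]
      linarith [Real.exp_one_lt_d9]
    calc _ = Real.exp 1 / (1 - a) * √(1 / a) * Real.exp (-K) := by ring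
      _ ≤ 6 * k * Real.exp (-K) := by gcongr

end mixDens

/-! ### The product estimator -/

/-- The product predictive density with marginals `mixDens`. -/
noncomputable def mixEstimator (n : ℕ) (r : ℝ≥0) (κ : ℝ) (hr : r ≠ 0) (hκ : 0 < κ) :
    PredictiveDensity n where
  dens x y := ∏ i, mixDens r κ (x i) (y i)
  measurable_dens := by
    refine Finset.measurable_prod _ fun i _ => ?_
    exact measurable_mixDens (α := (Fin n → ℝ) × (Fin n → ℝ)) (f := fun z => z.1 i)
      (g := fun z => z.2 i) (by fun_prop) (by fun_prop)
  dens_nonneg x y := Finset.prod_nonneg fun i _ => (mixDens_pos hr hκ _ _).le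
  lintegral_dens x := by
    simp_rw [ENNReal.ofReal_prod_of_nonneg fun i _ => (mixDens_pos hr hκ _ _).le]
    rw [volume_pi, lintegral_pi_prod _ (fun i y => ENNReal.ofReal (mixDens r κ (x i) y)) fun i =>
      (measurable_mixDens measurable_const measurable_id).ennreal_ofReal]
    simp [lintegral_mixDens hr hκ]

theorem loss_mixEstimator {n : ℕ} {r : ℝ≥0} {κ : ℝ} (hr : r ≠ 0) (hκ : 0 < κ)
    (θ x : Fin n → ℝ) :
    0 ≤ ∑ i, mixLoss r κ (θ i) (x i) ∧
      loss r θ (mixEstimator n r κ hr hκ) x = ENNReal.ofReal (∑ i, mixLoss r κ (θ i) (x i)) := by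
  have hP : normalVec θ r =
      volume.withDensity fun y => ENNReal.ofReal (∏ i, gaussianPDFReal (θ i) r (y i)) := by
    rw [normalVec_eq_withDensity θ hr]
    congr 1
    ext y
    rw [ENNReal.ofReal_prod_of_nonneg fun i _ => gaussianPDFReal_nonneg _ _ _]
    rfl
  have hf0 : ∀ y : Fin n → ℝ, 0 < ∏ i, gaussianPDFReal (θ i) r (y i) := fun y =>
    Finset.prod_pos fun i _ => gaussianPDFReal_pos _ _ _ hr
  have hq0 : ∀ y : Fin n → ℝ, 0 < ∏ i, mixDens r κ (x i) (y i) := fun y =>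
    Finset.prod_pos fun i _ => mixDens_pos hr hκ _ _
  have hlog : ∀ y : Fin n → ℝ, Real.log (∏ i, gaussianPDFReal (θ i) r (y i)) -
      Real.log (∏ i, mixDens r κ (x i) (y i)) =
      ∑ i, (Real.log (gaussianPDFReal (θ i) r (y i)) - Real.log (mixDens r κ (x i) (y i))) := by
    intro y
    rw [Real.log_prod fun i _ => (gaussianPDFReal_pos _ _ _ hr).ne',
      Real.log_prod fun i _ => (mixDens_pos hr hκ _ _).ne', Finset.sum_sub_distrib]
  have hi : ∀ i, Integrable (fun y : Fin n → ℝ =>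
      Real.log (gaussianPDFReal (θ i) r (y i)) - Real.log (mixDens r κ (x i) (y i)))
      (normalVec θ r) := fun i =>
    integrable_comp_eval (μ := fun i => gaussianReal (θ i) r)
      (integrable_mixLoss hr hκ (θ i) (x i))
  have hint : Integrable (fun y : Fin n → ℝ => Real.log (∏ i, gaussianPDFReal (θ i) r (y i)) -
      Real.log (∏ i, mixDens r κ (x i) (y i))) (normalVec θ r) := by
    simp_rw [hlog]
    exact integrable_finsetSum _ fun i _ => hi i
  have hI : ∫ y, (Real.log (∏ i, gaussianPDFReal (θ i) r (y i)) -
      Real.log (∏ i, mixDens r κ (x i) (y i))) ∂(normalVec θ r) =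
      ∑ i, mixLoss r κ (θ i) (x i) := by
    simp_rw [hlog]
    rw [integral_finsetSum _ fun i _ => hi i]
    refine Finset.sum_congr rfl fun i _ => ?_
    exact integral_comp_eval (μ := fun i => gaussianReal (θ i) r)
      (integrable_mixLoss hr hκ (θ i) (x i)).aestronglyMeasurable
  have h1 : IsProbabilityMeasure (volume.withDensity fun y : Fin n → ℝ =>
      ENNReal.ofReal (∏ i, gaussianPDFReal (θ i) r (y i))) := by
    rw [← hP]; infer_instance
  have h2 : IsProbabilityMeasure (volume.withDensity fun y : Fin n → ℝ =>
      ENNReal.ofReal (∏ i, mixDens r κ (x i) (y i))) :=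
    inferInstanceAs (IsProbabilityMeasure ((mixEstimator n r κ hr hκ).law x))
  rw [hP] at hint hI
  have key := klDiv_withDensity_of_pos (μ := volume)
    (f := fun y : Fin n → ℝ => ∏ i, gaussianPDFReal (θ i) r (y i))
    (q := fun y : Fin n → ℝ => ∏ i, mixDens r κ (x i) (y i))
    (Finset.measurable_prod _ fun i _ =>
      (measurable_gaussianPDFReal (θ i) r).comp (measurable_pi_apply i))
    ((mixEstimator n r κ hr hκ).measurable_right x) hf0 hq0 hint
  rw [hI] at key
  refine ⟨key.1, ?_⟩
  rw [loss, hP]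
  exact key.2

theorem risk_mixEstimator_le {n : ℕ} {r : ℝ≥0} (hr : r ≠ 0) {k : ℝ} (hk : 2 ≤ k)
    (θ : Fin n → ℝ) :
    risk r θ (mixEstimator n r (Real.exp (-(k ^ 2 / 2))) hr (Real.exp_pos _)) ≤
      ENNReal.ofReal (n * (6 * k * Real.exp (-(k ^ 2 / 2))) + hammingNorm θ * slabBound r k) := by
  set ρ₀ := 6 * k * Real.exp (-(k ^ 2 / 2)) with hρ₀
  have hρ₀0 : 0 ≤ ρ₀ := by positivity
  -- Nonzero coordinates are charged ρ₀ as well, so the sum splits into n·ρ₀ and a multiple of the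
  -- sparsity.
  have hb : ∀ t : ℝ, ∃ b : ℝ → ℝ, Integrable b (gaussianReal t 1) ∧
      (∀ x, mixLoss r (Real.exp (-(k ^ 2 / 2))) t x ≤ b x) ∧
      ∫ x, b x ∂(gaussianReal t 1) ≤ ρ₀ + if t ≠ 0 then slabBound r k else 0 := by
    intro t
    by_cases ht : t = 0
    · subst ht
      obtain ⟨b, h1, h2, h3⟩ := exists_mixLoss_zero_bound hr hk
      exact ⟨b, h1, h2, by simpa using h3⟩
    · obtain ⟨b, h1, h2, h3⟩ := exists_mixLoss_bound hr (by linarith : 0 ≤ k) t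
      refine ⟨b, h1, h2, h3.trans ?_⟩
      rw [if_pos ht]; linarith
  choose b hb1 hb2 hb3 using hb
  have hle : ∀ x : Fin n → ℝ, ∑ i, mixLoss r (Real.exp (-(k ^ 2 / 2))) (θ i) (x i) ≤
      ∑ i, b (θ i) (x i) := fun x => Finset.sum_le_sum fun i _ => hb2 _ _
  have hi : ∀ i, Integrable (fun x : Fin n → ℝ => b (θ i) (x i)) (normalVec θ 1) := fun i =>
    integrable_comp_eval (μ := fun i => gaussianReal (θ i) 1) (hb1 (θ i))
  calc risk r θ _ ≤ ∫⁻ x, ENNReal.ofReal (∑ i, b (θ i) (x i)) ∂(normalVec θ 1) := by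
        refine lintegral_mono fun x => ?_
        rw [(loss_mixEstimator hr (Real.exp_pos _) θ x).2]
        exact ENNReal.ofReal_le_ofReal (hle x)
    _ = ENNReal.ofReal (∫ x, ∑ i, b (θ i) (x i) ∂(normalVec θ 1)) := by
        rw [ofReal_integral_eq_lintegral_ofReal (integrable_finsetSum _ fun i _ => hi i)]
        exact Eventually.of_forall fun x =>
          (loss_mixEstimator hr (Real.exp_pos _) θ x).1.trans (hle x)
    _ ≤ _ := by
        refine ENNReal.ofReal_le_ofReal ?_
        rw [integral_finsetSum _ fun i _ => hi i]
        calc _ = ∑ i, ∫ x, b (θ i) x ∂(gaussianReal (θ i) 1) :=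
              Finset.sum_congr rfl fun i _ => integral_comp_eval
                (μ := fun i => gaussianReal (θ i) 1) (hb1 (θ i)).aestronglyMeasurable
          _ ≤ ∑ i, (ρ₀ + if θ i ≠ 0 then slabBound r k else 0) :=
              Finset.sum_le_sum fun i _ => hb3 (θ i)
          _ = _ := by
              rw [Finset.sum_add_distrib, Finset.sum_const, ← Finset.sum_filter, Finset.sum_const,
                Finset.card_univ, Fintype.card_fin, nsmul_eq_mul, nsmul_eq_mul]
              rfl

/-! ### The two-point prior and its products -/

theorem lintegral_twoPointPrior (η l : ℝ) (f : ℝ → ℝ≥0∞) :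
    ∫⁻ t, f t ∂(twoPointPrior η l) = ENNReal.ofReal (1 - η) * f 0 + ENNReal.ofReal η * f l := by
  simp [twoPointPrior, lintegral_add_measure, lintegral_smul_measure, lintegral_dirac]

theorem isProbabilityMeasure_twoPointPrior {η : ℝ} (h0 : 0 ≤ η) (h1 : η ≤ 1) (l : ℝ) :
    IsProbabilityMeasure (twoPointPrior η l) := by
  constructor
  have h := lintegral_twoPointPrior η l 1
  simp only [Pi.one_apply, lintegral_one, mul_one] at h
  rw [h, ← ENNReal.ofReal_add (by linarith) h0]
  simp

theorem ae_twoPointPrior (η l : ℝ) : ∀ᵐ t ∂(twoPointPrior η l), t = 0 ∨ t = l := by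
  rw [twoPointPrior, ae_add_measure_iff]
  constructor
  · exact Measure.ae_smul_measure ((ae_dirac_iff
      (((measurableSet_singleton 0).union (measurableSet_singleton l)))).mpr (Or.inl rfl)) _
  · exact Measure.ae_smul_measure ((ae_dirac_iff
      (((measurableSet_singleton 0).union (measurableSet_singleton l)))).mpr (Or.inr rfl)) _

theorem integrable_twoPointPrior (η l : ℝ) (f : ℝ → ℝ) : Integrable f (twoPointPrior η l) := by
  unfold twoPointPrior
  exact ((integrable_dirac (by simp)).smul_measure ENNReal.ofReal_ne_top).add_measure
    ((integrable_dirac (by simp)).smul_measure ENNReal.ofReal_ne_top)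

theorem integral_twoPointPrior {η : ℝ} (h0 : 0 ≤ η) (h1 : η ≤ 1) (l : ℝ) (f : ℝ → ℝ) :
    ∫ t, f t ∂(twoPointPrior η l) = (1 - η) * f 0 + η * f l := by
  unfold twoPointPrior
  rw [integral_add_measure ((integrable_dirac (by simp)).smul_measure ENNReal.ofReal_ne_top)
    ((integrable_dirac (by simp)).smul_measure ENNReal.ofReal_ne_top), integral_smul_measure,
    integral_smul_measure, integral_dirac, integral_dirac,
    ENNReal.toReal_ofReal (by linarith), ENNReal.toReal_ofReal h0]
  rfl

theorem hammingNorm_eq_sum {n : ℕ} (θ : Fin n → ℝ) :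
    (hammingNorm θ : ℝ) = ∑ i, if θ i ≠ 0 then (1 : ℝ) else 0 := by
  rw [← Finset.sum_filter, Finset.sum_const, nsmul_eq_mul, mul_one]
  rfl

theorem measurable_hammingNorm_real {n : ℕ} :
    Measurable fun θ : Fin n → ℝ => (hammingNorm θ : ℝ) := by
  simp_rw [hammingNorm_eq_sum]
  refine Finset.measurable_sum _ fun i _ => ?_
  refine Measurable.ite ?_ measurable_const measurable_const
  exact (measurableSet_singleton (0 : ℝ)).compl.preimage (measurable_pi_apply i)

theorem measurableSet_sparseSet (n : ℕ) (s : ℝ) : MeasurableSet (sparseSet n s) :=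
  measurableSet_le measurable_hammingNorm_real measurable_const

/-! ### The test function of the variational lower bound -/

/-- The logarithm of `p(y | θ, r) / p(y | 0, r) / (1 + t(x, y))`, where `t` is the posterior odds
of `l` against `0` given `(x, y)`. -/
noncomputable def testFun (r : ℝ≥0) (l e θ x y : ℝ) : ℝ :=
  θ * y / r - θ ^ 2 / (2 * r) - Real.log (1 + Real.exp (l * x + l * y / r - e ^ 2))

section testFun

variable {r : ℝ≥0} {l e η : ℝ}

theorem measurable_testFun {α : Type*} [MeasurableSpace α] {f g h : α → ℝ} (hf : Measurable f)
    (hg : Measurable g) (hh : Measurable h) :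
    Measurable fun a => testFun r l e (f a) (g a) (h a) := by
  unfold testFun
  fun_prop

/-- By `hη`, exp(-e²/2) is the prior odds of the spike, and `he` makes t the posterior odds. The
prior average is therefore (1-η)φ(x)(1+t)/(1+t), with y cancelled. -/
theorem twoPointPrior_testFun_le (hr : r ≠ 0) (he : l ^ 2 * (1 + 1 / (r : ℝ)) = e ^ 2)
    (h0 : 0 < η) (h1 : η < 1) (hη : η = (1 - η) * Real.exp (-(e ^ 2 / 2))) (x y : ℝ) :
    ∫⁻ θ, ENNReal.ofReal (gaussianPDFReal θ 1 x * Real.exp (testFun r l e θ x y))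
      ∂(twoPointPrior η l) ≤ ENNReal.ofReal (gaussianPDFReal 0 1 x) := by
  have hr' : (0 : ℝ) < r := by positivity
  have hφ := gaussianPDFReal_nonneg 0 1 x
  rw [lintegral_twoPointPrior, ← ENNReal.ofReal_mul (by linarith), ← ENNReal.ofReal_mul h0.le,
    ← ENNReal.ofReal_add (mul_nonneg (by linarith) (mul_nonneg hφ (Real.exp_pos _).le))
      (mul_nonneg h0.le (mul_nonneg (gaussianPDFReal_nonneg _ _ _) (Real.exp_pos _).le))]
  refine ENNReal.ofReal_le_ofReal ?_
  set t := Real.exp (l * x + l * y / r - e ^ 2) with ht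
  have ht0 : 0 < t := Real.exp_pos _
  have e0 : Real.exp (testFun r l e 0 x y) = (1 + t)⁻¹ := by
    rw [testFun, ← ht, ← Real.exp_log (show 0 < (1 + t)⁻¹ by positivity), Real.log_inv]
    congr 1; ring
  have e1 : Real.exp (testFun r l e l x y) =
      Real.exp (l * y / r - l ^ 2 / (2 * r)) * (1 + t)⁻¹ := by
    rw [testFun, ← ht, Real.exp_sub _ (Real.log (1 + t)), Real.exp_log (by positivity),
      div_eq_mul_inv]
  have e2 : gaussianPDFReal l 1 x = gaussianPDFReal 0 1 x * Real.exp (l * x - l ^ 2 / 2) := by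
    simp only [gaussianPDFReal]
    rw [mul_assoc (√_)⁻¹, ← Real.exp_add]
    congr 2
    rw [NNReal.coe_one]; ring
  have e3 : Real.exp (-(e ^ 2 / 2)) * (Real.exp (l * x - l ^ 2 / 2) *
      Real.exp (l * y / r - l ^ 2 / (2 * r))) = t := by
    rw [← Real.exp_add, ← Real.exp_add, ht]
    congr 1
    rw [← he]
    field_simp
    ring
  have e4 : η * (gaussianPDFReal l 1 x * Real.exp (testFun r l e l x y)) =
      (1 - η) * gaussianPDFReal 0 1 x * t * (1 + t)⁻¹ := by
    rw [e1, e2, ← e3]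
    nth_rewrite 1 [hη]
    ring
  rw [e4, e0]
  have e5 : (1 - η) * (gaussianPDFReal 0 1 x * (1 + t)⁻¹) +
      (1 - η) * gaussianPDFReal 0 1 x * t * (1 + t)⁻¹ = (1 - η) * gaussianPDFReal 0 1 x := by
    field_simp
  rw [e5]
  nlinarith

/-- The sum of `testFun` over the coordinates. -/
noncomputable def testSum {n : ℕ} (r : ℝ≥0) (l e : ℝ) (θ x y : Fin n → ℝ) : ℝ :=
  ∑ i, testFun r l e (θ i) (x i) (y i)

theorem measurable_testSum {n : ℕ} {α : Type*} [MeasurableSpace α] {f g h : α → Fin n → ℝ}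
    (hf : Measurable f) (hg : Measurable g) (hh : Measurable h) :
    Measurable fun a => testSum r l e (f a) (g a) (h a) :=
  Finset.measurable_sum Finset.univ fun i _ =>
    measurable_testFun (f := fun a => f a i) (g := fun a => g a i) (h := fun a => h a i)
      (by fun_prop) (by fun_prop) (by fun_prop)

theorem measurable_dens_comp {n : ℕ} (p : PredictiveDensity n) {α : Type*} [MeasurableSpace α]
    {g h : α → Fin n → ℝ} (hg : Measurable g) (hh : Measurable h) :
    Measurable fun a => ENNReal.ofReal (p.dens (g a) (h a)) :=
  (p.measurable_dens.comp (hg.prodMk hh)).ennreal_ofReal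

/-- The joint density of `x` and `y` under `N(θ, I) ⊗ p.law`, tilted by `exp testSum`. -/
noncomputable def tiltedDens {n : ℕ} (r : ℝ≥0) (l e : ℝ) (p : PredictiveDensity n)
    (θ x y : Fin n → ℝ) : ℝ≥0∞ :=
  ENNReal.ofReal (p.dens x y) *
    ∏ i, ENNReal.ofReal (gaussianPDFReal (θ i) 1 (x i) *
      Real.exp (testFun r l e (θ i) (x i) (y i)))

theorem measurable_ofReal_gaussianPDFReal_mul_exp_testFun {α : Type*} [MeasurableSpace α]
    {f g h : α → ℝ} (hf : Measurable f) (hg : Measurable g) (hh : Measurable h) :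
    Measurable fun a => ENNReal.ofReal (gaussianPDFReal (f a) 1 (g a) *
      Real.exp (testFun r l e (f a) (g a) (h a))) :=
  ((measurable_uncurry_gaussianPDFReal.comp (hf.prodMk (measurable_const.prodMk hg))).mul
    (measurable_testFun hf hg hh).exp).ennreal_ofReal

theorem measurable_tiltedDens {n : ℕ} (p : PredictiveDensity n) {α : Type*} [MeasurableSpace α]
    {f g h : α → Fin n → ℝ} (hf : Measurable f) (hg : Measurable g) (hh : Measurable h) :
    Measurable fun a => tiltedDens r l e p (f a) (g a) (h a) :=
  (measurable_dens_comp p hg hh).mul (Finset.measurable_prod Finset.univ fun i _ =>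
    measurable_ofReal_gaussianPDFReal_mul_exp_testFun (f := fun a => f a i) (g := fun a => g a i)
      (h := fun a => h a i) (by fun_prop) (by fun_prop) (by fun_prop))

/-- The expected exponential moment of `testSum`. -/
noncomputable def expMoment {n : ℕ} (r : ℝ≥0) (l e : ℝ) (p : PredictiveDensity n)
    (θ x : Fin n → ℝ) : ℝ≥0∞ :=
  ∫⁻ y, ENNReal.ofReal (Real.exp (testSum r l e θ x y)) ∂(p.law x)

theorem expMoment_eq {n : ℕ} (p : PredictiveDensity n) (θ x : Fin n → ℝ) :
    expMoment r l e p θ x =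
      ∫⁻ y, ENNReal.ofReal (p.dens x y) * ENNReal.ofReal (Real.exp (testSum r l e θ x y)) :=
  lintegral_withDensity_eq_lintegral_mul _ (p.measurable_right x).ennreal_ofReal
    (measurable_testSum measurable_const measurable_const measurable_id).exp.ennreal_ofReal

theorem measurable_expMoment {n : ℕ} (p : PredictiveDensity n) (θ : Fin n → ℝ) :
    Measurable (expMoment r l e p θ) := by
  have h : expMoment r l e p θ = fun x => _ := funext fun x => expMoment_eq p θ x
  rw [h]
  exact Measurable.lintegral_prod_right'
    (f := fun z : (Fin n → ℝ) × (Fin n → ℝ) => ENNReal.ofReal (p.dens z.1 z.2) *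
      ENNReal.ofReal (Real.exp (testSum r l e θ z.1 z.2)))
    ((measurable_dens_comp p measurable_fst measurable_snd).mul
      (measurable_testSum measurable_const measurable_fst measurable_snd).exp.ennreal_ofReal)

/-- Passing to Lebesgue densities frees the base measures of θ, so that θ can be integrated first.
-/
theorem lintegral_expMoment {n : ℕ} (p : PredictiveDensity n) (θ : Fin n → ℝ) :
    ∫⁻ x, expMoment r l e p θ x ∂(normalVec θ 1) = ∫⁻ x, ∫⁻ y, tiltedDens r l e p θ x y := by
  have hφ : Measurable fun x : Fin n → ℝ => ∏ i, gaussianPDF (θ i) 1 (x i) :=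
    Finset.measurable_prod Finset.univ fun i _ =>
      (measurable_gaussianPDF (θ i) 1).comp (measurable_pi_apply i)
  rw [normalVec_eq_withDensity θ one_ne_zero,
    lintegral_withDensity_eq_lintegral_mul _ hφ (measurable_expMoment p θ)]
  refine lintegral_congr fun x => ?_
  have hm : Measurable fun y : Fin n → ℝ =>
      ENNReal.ofReal (p.dens x y) * ENNReal.ofReal (Real.exp (testSum r l e θ x y)) :=
    (measurable_dens_comp p measurable_const measurable_id).mul
      (measurable_testSum measurable_const measurable_const measurable_id).exp.ennreal_ofReal
  rw [Pi.mul_apply, expMoment_eq, ← lintegral_const_mul _ hm]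
  refine lintegral_congr fun y => ?_
  rw [tiltedDens, testSum, Real.exp_sum,
    ENNReal.ofReal_prod_of_nonneg fun i _ => (Real.exp_pos _).le]
  simp_rw [ENNReal.ofReal_mul (gaussianPDFReal_nonneg _ _ _)]
  rw [Finset.prod_mul_distrib, mul_left_comm]
  rfl

theorem measurable_lintegral_tiltedDens {n : ℕ} (p : PredictiveDensity n) :
    Measurable fun z : (Fin n → ℝ) × (Fin n → ℝ) => ∫⁻ y, tiltedDens r l e p z.1 z.2 y :=
  Measurable.lintegral_prod_right'
    (f := fun z : ((Fin n → ℝ) × (Fin n → ℝ)) × (Fin n → ℝ) =>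
      tiltedDens r l e p z.1.1 z.1.2 z.2)
    (measurable_tiltedDens p (by fun_prop) (by fun_prop) (by fun_prop))

theorem measurable_lintegral_expMoment {n : ℕ} (p : PredictiveDensity n) :
    Measurable fun θ => ∫⁻ x, expMoment r l e p θ x ∂(normalVec θ 1) := by
  simp_rw [lintegral_expMoment]
  exact (measurable_lintegral_tiltedDens p).lintegral_prod_right'

/-- The exponential moment constraint of the variational lower bound. -/
theorem lintegral_expMoment_le_one (hr : r ≠ 0) (he : l ^ 2 * (1 + 1 / (r : ℝ)) = e ^ 2)
    (h0 : 0 < η) (h1 : η < 1) (hη : η = (1 - η) * Real.exp (-(e ^ 2 / 2))) {n : ℕ}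
    (p : PredictiveDensity n) :
    ∫⁻ θ, ∫⁻ x, expMoment r l e p θ x ∂(normalVec θ 1)
      ∂(Measure.pi fun _ : Fin n => twoPointPrior η l) ≤ 1 := by
  have := isProbabilityMeasure_twoPointPrior h0.le h1.le l
  set π := Measure.pi fun _ : Fin n => twoPointPrior η l with hπ
  simp_rw [lintegral_expMoment]
  have hF : Measurable (Function.uncurry fun θ x : Fin n → ℝ => ∫⁻ y, tiltedDens r l e p θ x y) :=
    measurable_lintegral_tiltedDens p
  -- With θ innermost, the estimator's density factors out and the rest is a product over
  -- coordinates; integrating y then uses only that the density has mass 1.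
  rw [lintegral_lintegral_swap hF.aemeasurable]
  have hle : ∀ x : Fin n → ℝ, ∫⁻ θ, (∫⁻ y, tiltedDens r l e p θ x y) ∂π ≤
      ∏ i, gaussianPDF 0 1 (x i) := by
    intro x
    have hFx : Measurable fun z : (Fin n → ℝ) × (Fin n → ℝ) => tiltedDens r l e p z.1 x z.2 :=
      measurable_tiltedDens p measurable_fst measurable_const measurable_snd
    rw [lintegral_lintegral_swap (f := fun θ y => tiltedDens r l e p θ x y) hFx.aemeasurable]
    calc ∫⁻ y, ∫⁻ θ, tiltedDens r l e p θ x y ∂π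
        ≤ ∫⁻ y, ENNReal.ofReal (p.dens x y) * ∏ i, gaussianPDF 0 1 (x i) := by
          refine lintegral_mono fun y => ?_
          unfold tiltedDens
          have hm : ∀ i, Measurable fun t => ENNReal.ofReal (gaussianPDFReal t 1 (x i) *
              Real.exp (testFun r l e t (x i) (y i))) := fun i =>
            measurable_ofReal_gaussianPDFReal_mul_exp_testFun measurable_id measurable_const
              measurable_const
          have hm' : Measurable fun θ : Fin n → ℝ => ∏ i, ENNReal.ofReal
              (gaussianPDFReal (θ i) 1 (x i) * Real.exp (testFun r l e (θ i) (x i) (y i))) :=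
            Finset.measurable_prod Finset.univ fun i _ => (hm i).comp (measurable_pi_apply i)
          rw [lintegral_const_mul _ hm', hπ,
            lintegral_pi_prod _ (fun i t => ENNReal.ofReal (gaussianPDFReal t 1 (x i) *
              Real.exp (testFun r l e t (x i) (y i)))) hm]
          gcongr with i
          exact twoPointPrior_testFun_le hr he h0 h1 hη (x i) (y i)
      _ = ∏ i, gaussianPDF 0 1 (x i) := by
          rw [lintegral_mul_const _ (p.measurable_right x).ennreal_ofReal, p.lintegral_dens, one_mul]
  refine (lintegral_mono hle).trans (le_of_eq ?_)
  rw [volume_pi, lintegral_pi_prod _ (fun _ => gaussianPDF 0 1) fun _ => measurable_gaussianPDF 0 1]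
  simp [lintegral_gaussianPDF_eq_one]

theorem log_one_add_exp_le (w : ℝ) : Real.log (1 + Real.exp w) ≤ Real.log 2 + |w| := by
  have h1 : Real.exp w ≤ Real.exp |w| := Real.exp_le_exp.mpr (le_abs_self w)
  have h2 : 1 ≤ Real.exp |w| := Real.one_le_exp (abs_nonneg w)
  calc _ ≤ Real.log (2 * Real.exp |w|) := Real.log_le_log (by positivity) (by linarith)
    _ = _ := by rw [Real.log_mul (by norm_num) (Real.exp_pos _).ne', Real.log_exp]

/-- The lower bound on the contribution of a spike to the Bayes risk. -/
noncomputable def spikeBound (r : ℝ≥0) (l : ℝ) : ℝ :=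
  l ^ 2 / (2 * r) - Real.log 2 - l * (1 + (1 + r) / (2 * r))

/-- Since log(1+t) ≤ t, the minorant is -t, and the mean of t under θ = 0 is exactly the prior odds.
Minorants are used so that all integrals are explicit. -/
theorem exists_le_testFun_zero (hr : r ≠ 0) (he : l ^ 2 * (1 + 1 / (r : ℝ)) = e ^ 2) :
    ∃ low : ℝ → ℝ → ℝ, (∀ x y, low x y ≤ testFun r l e 0 x y) ∧ (∀ x, Measurable (low x)) ∧
      (∀ x, Integrable (low x) (gaussianReal 0 r)) ∧
      Integrable (fun x => ∫ y, low x y ∂(gaussianReal 0 r)) (gaussianReal 0 1) ∧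
      -Real.exp (-(e ^ 2 / 2)) ≤ ∫ x, ∫ y, low x y ∂(gaussianReal 0 r) ∂(gaussianReal 0 1) := by
  have hr' : (0 : ℝ) < r := by positivity
  have hmgf : ∀ (v : ℝ≥0) (t : ℝ), ∫ y, Real.exp (t * y) ∂(gaussianReal 0 v) =
      Real.exp (v * t ^ 2 / 2) := by
    intro v t
    have h := congrFun (mgf_fun_id_gaussianReal (μ := 0) (v := v)) t
    rw [zero_mul, zero_add] at h
    exact h
  have hin : ∀ x : ℝ, ∫ y, -(Real.exp (-e ^ 2) * Real.exp (l * x)) * Real.exp (l / r * y)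
      ∂(gaussianReal 0 r) = -(Real.exp (-e ^ 2) * Real.exp (r * (l / r) ^ 2 / 2)) *
        Real.exp (l * x) := by
    intro x
    rw [integral_const_mul, hmgf]
    ring
  refine ⟨fun x y => -(Real.exp (-e ^ 2) * Real.exp (l * x)) * Real.exp (l / r * y), fun x y => ?_,
    fun x => by fun_prop, fun x => (integrable_exp_mul_gaussianReal _).const_mul _, ?_, ?_⟩
  · have h1 : Real.exp (-e ^ 2) * Real.exp (l * x) * Real.exp (l / r * y) =
        Real.exp (l * x + l * y / r - e ^ 2) := by
      rw [← Real.exp_add, ← Real.exp_add]; congr 1; ring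
    have h2 := Real.log_le_sub_one_of_pos
      (show 0 < 1 + Real.exp (l * x + l * y / r - e ^ 2) by positivity)
    beta_reduce
    rw [neg_mul, h1, testFun]
    simp only [zero_mul, zero_div, ne_eq, OfNat.ofNat_ne_zero, not_false_eq_true, zero_pow, sub_zero,
      zero_sub]
    linarith
  · simp_rw [hin]
    exact (integrable_exp_mul_gaussianReal _).const_mul _
  · simp_rw [hin]
    rw [integral_const_mul, hmgf, neg_mul, ← Real.exp_add, ← Real.exp_add, NNReal.coe_one]
    refine le_of_eq ?_
    congr 2
    have : r * (l / r) ^ 2 / 2 = l ^ 2 * (1 + 1 / (r : ℝ)) / 2 - l ^ 2 / 2 := by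
      field_simp; ring
    rw [this, he]
    ring

/-- Under the spike, `he` makes the exponent of t equal to l(x-l) + (l/r)(y-l), which is centred;
hence log(1+t) costs only O(l+1) against the main term. -/
theorem exists_le_testFun_spike (hr : r ≠ 0) (hl : 0 < l)
    (he : l ^ 2 * (1 + 1 / (r : ℝ)) = e ^ 2) :
    ∃ low : ℝ → ℝ → ℝ, (∀ x y, low x y ≤ testFun r l e l x y) ∧ (∀ x, Measurable (low x)) ∧
      (∀ x, Integrable (low x) (gaussianReal l r)) ∧
      Integrable (fun x => ∫ y, low x y ∂(gaussianReal l r)) (gaussianReal l 1) ∧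
      spikeBound r l ≤ ∫ x, ∫ y, low x y ∂(gaussianReal l r) ∂(gaussianReal l 1) := by
  have hr' : (0 : ℝ) < r := by positivity
  have hi : ∀ x : ℝ, Integrable (fun y => l / r * y - l / r / 2 * (y - l) ^ 2) (gaussianReal l r) :=
    fun x => ((integrable_id_gaussianReal l r).const_mul _).sub
      ((integrable_sub_sq_gaussianReal l l r).const_mul _)
  have hin : ∀ x : ℝ, ∫ y, ((-(l ^ 2 / (2 * r)) - Real.log 2 - l * (1 + (x - l) ^ 2) / 2 - l / r / 2) +
      (l / r * y - l / r / 2 * (y - l) ^ 2)) ∂(gaussianReal l r) =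
      spikeBound r l + l / 2 - l / 2 * (x - l) ^ 2 := by
    intro x
    refine (integral_add (integrable_const _) (hi x)).trans ?_
    rw [integral_sub ((integrable_id_gaussianReal l r).const_mul _)
      ((integrable_sub_sq_gaussianReal l l r).const_mul _), integral_const_mul, integral_const_mul,
      integral_sub_sq_gaussianReal, integral_id_gaussianReal, spikeBound]
    simp only [integral_const, probReal_univ, smul_eq_mul, one_mul]
    field_simp
    ring
  refine ⟨fun x y => (-(l ^ 2 / (2 * r)) - Real.log 2 - l * (1 + (x - l) ^ 2) / 2 - l / r / 2) +
      (l / r * y - l / r / 2 * (y - l) ^ 2), fun x y => ?_, fun x => by fun_prop,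
      fun x => (integrable_const _).add (hi x), ?_, ?_⟩
  · have h1 := log_one_add_exp_le (l * x + l * y / r - e ^ 2)
    have h2 : l * x + l * y / r - e ^ 2 = l * (x - l) + l / r * (y - l) := by
      rw [← he]; field_simp; ring
    have h3 : |l * (x - l) + l / r * (y - l)| ≤
        l * ((1 + (x - l) ^ 2) / 2) + l / r * ((1 + (y - l) ^ 2) / 2) := by
      refine (abs_add_le _ _).trans ?_
      rw [abs_mul, abs_mul, abs_of_pos hl, abs_of_pos (div_pos hl hr')]
      gcongr
      · nlinarith [sq_abs (x - l), sq_nonneg (|x - l| - 1)]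
      · nlinarith [sq_abs (y - l), sq_nonneg (|y - l| - 1)]
    rw [h2] at h1
    rw [testFun, h2]
    have h4 : l * y / r = l / r * y := by ring
    rw [h4]
    linarith
  · simp_rw [hin]
    exact (integrable_const _).sub ((integrable_sub_sq_gaussianReal l l 1).const_mul _)
  · simp_rw [hin]
    rw [integral_sub (integrable_const _) ((integrable_sub_sq_gaussianReal l l 1).const_mul _),
      integral_const_mul, integral_sub_sq_gaussianReal]
    simp

/-- The variational inequality is applied to the sum of minorants, and monotonicity of exp restores
`testSum`. The exponential moment stays on the right because only its prior average is controlled.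
-/
theorem ofReal_le_risk_add (hr : r ≠ 0) (hl : 0 < l) (he : l ^ 2 * (1 + 1 / (r : ℝ)) = e ^ 2)
    {n : ℕ} (p : PredictiveDensity n) {θ : Fin n → ℝ} (hθ : ∀ i, θ i = 0 ∨ θ i = l) :
    ENNReal.ofReal (1 + (hammingNorm θ * spikeBound r l - n * Real.exp (-(e ^ 2 / 2)))) ≤
      risk r θ p + ∫⁻ x, expMoment r l e p θ x ∂(normalVec θ 1) := by
  have hlow : ∀ i, ∃ low : ℝ → ℝ → ℝ, (∀ x y, low x y ≤ testFun r l e (θ i) x y) ∧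
      (∀ x, Measurable (low x)) ∧ (∀ x, Integrable (low x) (gaussianReal (θ i) r)) ∧
      Integrable (fun x => ∫ y, low x y ∂(gaussianReal (θ i) r)) (gaussianReal (θ i) 1) ∧
      (if θ i ≠ 0 then spikeBound r l else 0) - Real.exp (-(e ^ 2 / 2)) ≤
        ∫ x, ∫ y, low x y ∂(gaussianReal (θ i) r) ∂(gaussianReal (θ i) 1) := by
    intro i
    rcases hθ i with h | h
    · obtain ⟨low, a1, a2, a3, a4, a5⟩ := exists_le_testFun_zero hr he
      rw [h]
      exact ⟨low, a1, a2, a3, a4, by simpa using a5⟩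
    · obtain ⟨low, a1, a2, a3, a4, a5⟩ := exists_le_testFun_spike hr hl he
      rw [h]
      refine ⟨low, a1, a2, a3, a4, ?_⟩
      rw [if_pos hl.ne']
      linarith [Real.exp_pos (-(e ^ 2 / 2))]
  choose low a1 a2 a3 a4 a5 using hlow
  rw [risk, ← lintegral_add_right _ (measurable_expMoment p θ)]
  have hix : ∀ i, Integrable (fun x : Fin n → ℝ => ∫ y, low i (x i) y ∂(gaussianReal (θ i) r))
      (normalVec θ 1) := fun i =>
    integrable_comp_eval (μ := fun i => gaussianReal (θ i) 1) (a4 i)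
  have hiy : ∀ (x : Fin n → ℝ) i, Integrable (fun y : Fin n → ℝ => low i (x i) (y i))
      (normalVec θ r) := fun x i =>
    integrable_comp_eval (μ := fun i => gaussianReal (θ i) r) (a3 i (x i))
  have hpt : ∀ x : Fin n → ℝ,
      ENNReal.ofReal (1 + ∑ i, ∫ y, low i (x i) y ∂(gaussianReal (θ i) r)) ≤
      loss r θ p x + expMoment r l e p θ x := by
    intro x
    have h := ofReal_one_add_integral_le_klDiv_add (normalVec θ r) (p.law x)
      (g := fun y => ∑ i, low i (x i) (y i))
      (Finset.measurable_sum Finset.univ fun i _ => (a2 i (x i)).comp (measurable_pi_apply i))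
      (integrable_finsetSum _ fun i _ => hiy x i)
    have h' : ∫ y, ∑ i, low i (x i) (y i) ∂(normalVec θ r) =
        ∑ i, ∫ y, low i (x i) y ∂(gaussianReal (θ i) r) := by
      rw [integral_finsetSum _ fun i _ => hiy x i]
      exact Finset.sum_congr rfl fun i _ => integral_comp_eval
        (μ := fun i => gaussianReal (θ i) r) (a3 i (x i)).aestronglyMeasurable
    rw [h'] at h
    refine h.trans (add_le_add le_rfl (lintegral_mono fun y => ?_))
    exact ENNReal.ofReal_le_ofReal (Real.exp_le_exp.mpr
      (Finset.sum_le_sum fun i _ => a1 i (x i) (y i)))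
  refine le_trans ?_ ((ofReal_integral_le_lintegral _).trans (lintegral_mono hpt))
  refine ENNReal.ofReal_le_ofReal ?_
  rw [integral_add (integrable_const _) (integrable_finsetSum _ fun i _ => hix i),
    integral_finsetSum _ fun i _ => hix i]
  simp only [integral_const, probReal_univ, smul_eq_mul, one_mul]
  gcongr
  calc _ = ∑ i, ((if θ i ≠ 0 then spikeBound r l else 0) - Real.exp (-(e ^ 2 / 2))) := by
        rw [Finset.sum_sub_distrib, hammingNorm_eq_sum, Finset.sum_mul]
        simp
    _ ≤ ∑ i, ∫ x, ∫ y, low i x y ∂(gaussianReal (θ i) r) ∂(gaussianReal (θ i) 1) :=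
        Finset.sum_le_sum fun i _ => a5 i
    _ = _ := Finset.sum_congr rfl fun i _ => (integral_comp_eval
        (μ := fun i => gaussianReal (θ i) 1) (a4 i).aestronglyMeasurable).symm

/-- The Bayes risk restricted to a measurable set of parameters is bounded below in terms of the
expected number of spikes on that set. -/
theorem ofReal_le_setLIntegral_risk_add_one (hr : r ≠ 0) (hl : 0 < l)
    (he : l ^ 2 * (1 + 1 / (r : ℝ)) = e ^ 2)
    (h0 : 0 < η) (h1 : η < 1) (hη : η = (1 - η) * Real.exp (-(e ^ 2 / 2))) {n : ℕ}
    (p : PredictiveDensity n) (Θ : Set (Fin n → ℝ)) :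
    ENNReal.ofReal ((∫ θ in Θ, (hammingNorm θ : ℝ)
        ∂(Measure.pi fun _ : Fin n => twoPointPrior η l)) * spikeBound r l -
        n * Real.exp (-(e ^ 2 / 2))) ≤
      ∫⁻ θ in Θ, risk r θ p ∂(Measure.pi fun _ : Fin n => twoPointPrior η l) + 1 := by
  have := isProbabilityMeasure_twoPointPrior h0.le h1.le l
  have hB := lintegral_expMoment_le_one hr he h0 h1 hη p
  set π := Measure.pi fun _ : Fin n => twoPointPrior η l with hπ
  have hae : ∀ᵐ θ ∂π, ∀ i, θ i = 0 ∨ θ i = l := by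
    rw [ae_all_iff]
    exact fun i => (measurePreserving_eval (fun _ : Fin n => twoPointPrior η l)
      i).quasiMeasurePreserving.ae (ae_twoPointPrior η l)
  have hN : Integrable (fun θ : Fin n → ℝ => (hammingNorm θ : ℝ)) (π.restrict Θ) := by
    refine Integrable.of_bound measurable_hammingNorm_real.aestronglyMeasurable n
      (Eventually.of_forall fun θ => ?_)
    rw [Real.norm_of_nonneg (Nat.cast_nonneg _)]
    exact_mod_cast (hammingNorm_le_card_fintype (x := θ)).trans_eq (Fintype.card_fin n)
  calc _ ≤ ENNReal.ofReal (∫ θ in Θ, (1 + (hammingNorm θ * spikeBound r l -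
          n * Real.exp (-(e ^ 2 / 2)))) ∂π) := by
        refine ENNReal.ofReal_le_ofReal ?_
        refine le_of_le_of_eq ?_ (integral_add (integrable_const _)
          ((hN.mul_const _).sub (integrable_const _))).symm
        simp only [Pi.sub_apply]
        rw [integral_sub (hN.mul_const _) (integrable_const _), integral_mul_const]
        simp only [integral_const, smul_eq_mul, measureReal_restrict_apply_univ]
        have h2 : π.real Θ ≤ 1 := measureReal_le_one
        have h3 : 0 ≤ π.real Θ := measureReal_nonneg
        have h4 : 0 ≤ n * Real.exp (-(e ^ 2 / 2)) := by positivity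
        -- The constant 1 integrates to π(Θ) ≥ 0 and is dropped; the error term is multiplied by
        -- π(Θ) ≤ 1.
        nlinarith
    _ ≤ ∫⁻ θ in Θ, ENNReal.ofReal (1 + (hammingNorm θ * spikeBound r l -
          n * Real.exp (-(e ^ 2 / 2)))) ∂π := ofReal_integral_le_lintegral _
    _ ≤ ∫⁻ θ in Θ, (risk r θ p +
        ∫⁻ x, expMoment r l e p θ x ∂(normalVec θ 1)) ∂π := by
        refine lintegral_mono_ae ?_
        filter_upwards [ae_restrict_of_ae hae] with θ hθ
        exact ofReal_le_risk_add hr hl he p hθ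
    _ = ∫⁻ θ in Θ, risk r θ p ∂π + ∫⁻ θ in Θ, ∫⁻ x, expMoment r l e p θ x ∂(normalVec θ 1) ∂π :=
        lintegral_add_right _ (measurable_lintegral_expMoment p)
    -- Restricting to Θ only decreases the exponential moment, so the prior need not be conditioned
    -- on Θ.
    _ ≤ _ := add_le_add le_rfl ((setLIntegral_le_lintegral _ _).trans hB)

end testFun

/-! ### The number of spikes under the i.i.d. prior -/

section Count

variable {n : ℕ} {η l : ℝ}

theorem hammingNorm_le_nat (θ : Fin n → ℝ) : (hammingNorm θ : ℝ) ≤ n := by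
  exact_mod_cast (hammingNorm_le_card_fintype (x := θ)).trans_eq (Fintype.card_fin n)

theorem integrable_hammingNorm (μ : Measure (Fin n → ℝ)) [IsFiniteMeasure μ] :
    Integrable (fun θ => (hammingNorm θ : ℝ)) μ := by
  refine Integrable.of_bound measurable_hammingNorm_real.aestronglyMeasurable n
    (Eventually.of_forall fun θ => ?_)
  rw [Real.norm_of_nonneg (Nat.cast_nonneg _)]
  exact hammingNorm_le_nat θ

theorem measurable_ite_ne_zero : Measurable fun t : ℝ => if t ≠ 0 then (1 : ℝ) else 0 :=
  Measurable.ite (measurableSet_singleton (0 : ℝ)).compl measurable_const measurable_const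

theorem integral_hammingNorm (h0 : 0 ≤ η) (h1 : η ≤ 1) (hl : l ≠ 0) :
    ∫ θ, (hammingNorm θ : ℝ) ∂(Measure.pi fun _ : Fin n => twoPointPrior η l) = n * η := by
  have := isProbabilityMeasure_twoPointPrior h0 h1 l
  simp_rw [hammingNorm_eq_sum]
  rw [integral_finsetSum _ fun i _ => integrable_comp_eval
    (μ := fun _ : Fin n => twoPointPrior η l) (i := i)
    (integrable_twoPointPrior η l fun t => if t ≠ 0 then (1 : ℝ) else 0)]
  have h : ∀ i : Fin n, ∫ θ : Fin n → ℝ, (if θ i ≠ 0 then (1 : ℝ) else 0)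
      ∂(Measure.pi fun _ : Fin n => twoPointPrior η l) = η := by
    intro i
    rw [integral_comp_eval (μ := fun _ : Fin n => twoPointPrior η l)
      (f := fun t => if t ≠ 0 then (1 : ℝ) else 0) (i := i)
      measurable_ite_ne_zero.aestronglyMeasurable, integral_twoPointPrior h0 h1]
    simp [hl]
  rw [Finset.sum_congr rfl fun i _ => h i]
  simp

theorem integral_hammingNorm_sub_sq_le (h0 : 0 ≤ η) (h1 : η ≤ 1) (hl : l ≠ 0) :
    ∫ θ, ((hammingNorm θ : ℝ) - n * η) ^ 2
      ∂(Measure.pi fun _ : Fin n => twoPointPrior η l) ≤ n * η := by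
  have := isProbabilityMeasure_twoPointPrior h0 h1 l
  have hmem : MemLp (fun t : ℝ => if t ≠ 0 then (1 : ℝ) else 0) 2 (twoPointPrior η l) := by
    refine MemLp.of_bound measurable_ite_ne_zero.aestronglyMeasurable 1
      (Eventually.of_forall fun t => ?_)
    split_ifs <;> simp
  have hvar := variance_sum_pi (μ := fun _ : Fin n => twoPointPrior η l)
    (X := fun _ t => if t ≠ 0 then (1 : ℝ) else 0) fun _ => hmem
  have hsum : (∑ i : Fin n, fun θ : Fin n → ℝ => if θ i ≠ 0 then (1 : ℝ) else 0) =
      fun θ => (hammingNorm θ : ℝ) := by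
    ext θ
    rw [hammingNorm_eq_sum, Finset.sum_apply]
  rw [hsum, variance_eq_integral measurable_hammingNorm_real.aemeasurable,
    integral_hammingNorm h0 h1 hl] at hvar
  rw [hvar]
  have hle : Var[fun t : ℝ => if t ≠ 0 then (1 : ℝ) else 0; twoPointPrior η l] ≤ η := by
    refine (variance_le_expectation_sq measurable_ite_ne_zero.aestronglyMeasurable).trans ?_
    rw [integral_twoPointPrior h0 h1]
    simp [hl]
  simpa using mul_le_mul_of_nonneg_left hle (Nat.cast_nonneg n)

/-- The expected number of spikes on the event that it is at most `n η + d`. -/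
theorem le_setIntegral_hammingNorm (h0 : 0 ≤ η) (h1 : η ≤ 1) (hl : l ≠ 0) {d : ℝ} (hd : 0 < d) :
    n * η - n * η * (1 / d + n * η / d ^ 2) ≤
      ∫ θ in sparseSet n (n * η + d), (hammingNorm θ : ℝ)
        ∂(Measure.pi fun _ : Fin n => twoPointPrior η l) := by
  have := isProbabilityMeasure_twoPointPrior h0 h1 l
  set π := Measure.pi fun _ : Fin n => twoPointPrior η l with hπ
  set a := n * η with ha
  have ha0 : 0 ≤ a := by positivity
  have hsq : Integrable (fun θ : Fin n → ℝ => ((hammingNorm θ : ℝ) - a) ^ 2) π := by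
    refine Integrable.of_bound ((measurable_hammingNorm_real.sub_const a).pow_const
      2).aestronglyMeasurable ((n + a) ^ 2) (Eventually.of_forall fun θ => ?_)
    have h2 := hammingNorm_le_nat θ
    have h3 : (0 : ℝ) ≤ hammingNorm θ := Nat.cast_nonneg _
    rw [Real.norm_of_nonneg (sq_nonneg _)]
    exact sq_le_sq' (by linarith) (by linarith)
  rw [← integral_indicator (measurableSet_sparseSet _ _)]
  -- Off the set, u = N - a exceeds d, so u ≤ u²/d and a ≤ a·u²/d²; the quadratic penalty then
  -- absorbs N = u + a.
  have hpt : ∀ θ : Fin n → ℝ,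
      (hammingNorm θ : ℝ) - (1 / d + a / d ^ 2) * ((hammingNorm θ : ℝ) - a) ^ 2 ≤
      (sparseSet n (a + d)).indicator (fun θ => (hammingNorm θ : ℝ)) θ := by
    intro θ
    by_cases hθ : θ ∈ sparseSet n (a + d)
    · rw [Set.indicator_of_mem hθ]
      have : 0 ≤ (1 / d + a / d ^ 2) * ((hammingNorm θ : ℝ) - a) ^ 2 := by positivity
      linarith
    · rw [Set.indicator_of_notMem hθ]
      simp only [sparseSet, Set.mem_ofPred_eq, not_le] at hθ
      set u := (hammingNorm θ : ℝ) - a with hu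
      have hu1 : 1 ≤ u / d := by rw [le_div_iff₀ hd]; linarith
      have e1 : (1 / d + a / d ^ 2) * u ^ 2 = u * (u / d) + a * (u / d) ^ 2 := by
        field_simp
      have hN : (hammingNorm θ : ℝ) = u + a := by rw [hu]; ring
      rw [e1, hN]
      have h2 : u * 1 ≤ u * (u / d) := mul_le_mul_of_nonneg_left hu1 (by linarith)
      have h3 : a * 1 ≤ a * (u / d) ^ 2 := mul_le_mul_of_nonneg_left (by nlinarith) ha0
      linarith
  have hV := integral_hammingNorm_sub_sq_le (n := n) h0 h1 hl
  rw [← ha, ← hπ] at hV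
  refine le_trans ?_ (integral_mono ((integrable_hammingNorm π).sub (hsq.const_mul _))
    ((integrable_hammingNorm π).indicator (measurableSet_sparseSet _ _)) hpt)
  refine le_of_le_of_eq ?_ (integral_sub (integrable_hammingNorm π) (hsq.const_mul _)).symm
  rw [integral_hammingNorm h0 h1 hl, integral_const_mul]
  have h4 := mul_le_mul_of_nonneg_left hV (show 0 ≤ 1 / d + a / d ^ 2 by positivity)
  linarith

end Count

/-! ### The thresholds -/

section Threshold

variable {r : ℝ≥0} {η η' : ℝ}

theorem lambdaE_sq (h0 : 0 < η) (h1 : η ≤ 1 / 2) :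
    lambdaE η ^ 2 = 2 * Real.log (η⁻¹ * (1 - η)) := by
  refine Real.sq_sqrt (mul_nonneg zero_le_two (Real.log_nonneg ?_))
  rw [inv_mul_eq_div, le_div_iff₀ h0]
  linarith

theorem eq_mul_exp_lambdaE (h0 : 0 < η) (h1 : η ≤ 1 / 2) :
    η = (1 - η) * Real.exp (-(lambdaE η ^ 2 / 2)) := by
  have h2 : 0 < 1 - η := by linarith
  rw [lambdaE_sq h0 h1, mul_div_cancel_left₀ _ two_ne_zero, Real.exp_neg,
    Real.exp_log (by positivity)]
  field_simp

theorem oracleVar_nonneg : 0 ≤ oracleVar r := by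
  unfold oracleVar; positivity

theorem lambdaF_sq_mul (hr : r ≠ 0) (η : ℝ) :
    lambdaF r η ^ 2 * (1 + 1 / (r : ℝ)) = lambdaE η ^ 2 := by
  have hr' : (0 : ℝ) < r := by positivity
  rw [lambdaF, mul_pow, Real.sq_sqrt oracleVar_nonneg, oracleVar]
  field_simp

theorem lambdaF_pos (hr : r ≠ 0) (h0 : 0 < η) (h1 : η < 1 / 2) : 0 < lambdaF r η := by
  have hr' : (0 : ℝ) < r := by positivity
  have hv : 0 < oracleVar r := by unfold oracleVar; positivity
  refine mul_pos (Real.sqrt_pos.mpr hv) (Real.sqrt_pos.mpr (mul_pos two_pos (Real.log_pos ?_)))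
  rw [inv_mul_eq_div, lt_div_iff₀ h0]
  linarith

/-- A lower bound on `spikeBound` at `lambdaF`, in terms of `k = √(2 log (1 / η))`. -/
noncomputable def spikeLower (r : ℝ≥0) (k : ℝ) : ℝ :=
  (k ^ 2 / 2 - 1) / (1 + r) - 1 - (k + 2) * (1 + (1 + r) / (2 * r))

/-- Halving η at most shifts λ_e² by a bounded amount, so one bound covers both the prior with
sparsity η and the thinned one. -/
theorem spikeLower_le (hr : r ≠ 0) (h0 : 0 < η') (hle : η' ≤ η) (h1 : η ≤ 1 / 2)
    (h2 : η ≤ 2 * η') {k : ℝ} (hk : 0 ≤ k) (hkη : Real.exp (-(k ^ 2 / 2)) = η) :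
    spikeLower r k ≤ spikeBound r (lambdaF r η') := by
  have hr' : (0 : ℝ) < r := by positivity
  have hlog2 : Real.log 2 ≤ 1 := by
    have := Real.log_le_sub_one_of_pos (x := 2) (by norm_num); linarith
  have hη0 : 0 < η := h0.trans_le hle
  have hlogη : Real.log η⁻¹ = k ^ 2 / 2 := by rw [Real.log_inv, ← hkη, Real.log_exp]; ring
  have hsq := lambdaE_sq h0 (hle.trans h1)
  have hlow : k ^ 2 - 2 ≤ lambdaE η' ^ 2 := by
    have h3 : Real.log (η⁻¹ * 2⁻¹) ≤ Real.log (η'⁻¹ * (1 - η')) := by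
      refine Real.log_le_log (by positivity) ?_
      have : η⁻¹ ≤ η'⁻¹ := inv_anti₀ h0 hle
      gcongr
      linarith
    rw [Real.log_mul (by positivity) (by norm_num), hlogη, Real.log_inv] at h3
    linarith
  have hup : lambdaE η' ^ 2 ≤ (k + 2) ^ 2 := by
    have h3 : Real.log (η'⁻¹ * (1 - η')) ≤ Real.log (2 * η⁻¹) := by
      refine Real.log_le_log (mul_pos (inv_pos.mpr h0) (by linarith)) ?_
      have h4 : η'⁻¹ ≤ 2 * η⁻¹ := by
        rw [inv_le_iff_one_le_mul₀ h0, mul_assoc, mul_comm η⁻¹, ← mul_assoc, ← div_eq_mul_inv,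
          le_div_iff₀ hη0]
        linarith
      calc η'⁻¹ * (1 - η') ≤ η'⁻¹ * 1 := by gcongr; linarith
        _ ≤ _ := by rwa [mul_one]
    rw [Real.log_mul two_ne_zero (inv_pos.mpr hη0).ne', hlogη] at h3
    nlinarith
  have hF : lambdaF r η' ≤ k + 2 := by
    have h3 : lambdaE η' ≤ k + 2 := abs_le_of_sq_le_sq' hup (by linarith) |>.2
    have h4 : √(oracleVar r) ≤ 1 := by
      refine Real.sqrt_le_one.mpr ?_
      unfold oracleVar
      exact inv_le_one_of_one_le₀ (by have := inv_pos.mpr hr'; linarith)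
    calc lambdaF r η' ≤ 1 * lambdaE η' := mul_le_mul_of_nonneg_right h4 (Real.sqrt_nonneg _)
      _ ≤ k + 2 := by linarith
  have hF2 : lambdaF r η' ^ 2 / (2 * r) = lambdaE η' ^ 2 / 2 / (1 + r) := by
    rw [← lambdaF_sq_mul hr η']
    field_simp
    ring
  rw [spikeBound, hF2, spikeLower]
  have h5 : (k ^ 2 / 2 - 1) / (1 + r : ℝ) ≤ lambdaE η' ^ 2 / 2 / (1 + r) := by
    gcongr; linarith
  have h6 : lambdaF r η' * (1 + (1 + r) / (2 * r : ℝ)) ≤ (k + 2) * (1 + (1 + r) / (2 * r)) := by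
    gcongr
  linarith

end Threshold

/-! ### Non-asymptotic bounds on the Bayes and minimax risks -/

section Bounds

variable {r : ℝ≥0} {η k : ℝ} {n : ℕ}

/-- The common upper bound on the minimax and Bayes risks, per spike. -/
noncomputable def riskUpper (r : ℝ≥0) (k : ℝ) : ℝ := 6 * k + slabBound r k

theorem riskUpper_nonneg (hr : r ≠ 0) (hk : 0 ≤ k) : 0 ≤ riskUpper r k :=
  add_nonneg (by positivity) (slabBound_nonneg hr hk)

theorem minimaxRisk_le (hr : r ≠ 0) (hk : 2 ≤ k) (hkη : Real.exp (-(k ^ 2 / 2)) = η) :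
    minimaxRisk r (sparseSet n (n * η)) ≤ ENNReal.ofReal (n * η * riskUpper r k) := by
  refine (iInf_le _ (mixEstimator n r (Real.exp (-(k ^ 2 / 2))) hr (Real.exp_pos _))).trans ?_
  refine iSup₂_le fun θ hθ => (risk_mixEstimator_le hr hk θ).trans (ENNReal.ofReal_le_ofReal ?_)
  have h1 : (hammingNorm θ : ℝ) * slabBound r k ≤ n * η * slabBound r k :=
    mul_le_mul_of_nonneg_right hθ (slabBound_nonneg hr (by linarith))
  rw [hkη, riskUpper]
  linarith

theorem bayesRisk_le (hr : r ≠ 0) (hk : 2 ≤ k) (hkη : Real.exp (-(k ^ 2 / 2)) = η)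
    (h1 : η < 1 / 2) :
    bayesRisk r (iidPrior n r η) ≤ ENNReal.ofReal (n * η * riskUpper r k) := by
  have h0 : 0 < η := hkη ▸ Real.exp_pos _
  have hl := lambdaF_pos hr h0 h1
  have := isProbabilityMeasure_twoPointPrior h0.le (by linarith : η ≤ 1) (lambdaF r η)
  refine (iInf_le _ (mixEstimator n r (Real.exp (-(k ^ 2 / 2))) hr (Real.exp_pos _))).trans ?_
  refine (lintegral_mono fun θ => risk_mixEstimator_le hr hk θ).trans ?_
  have hprob : IsProbabilityMeasure (iidPrior n r η) := by unfold iidPrior; infer_instance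
  have hi := (integrable_hammingNorm (iidPrior n r η)).mul_const (slabBound r k)
  have hslab := slabBound_nonneg hr (by linarith : 0 ≤ k)
  have hi' : Integrable (fun θ : Fin n → ℝ => n * (6 * k * Real.exp (-(k ^ 2 / 2))) +
      hammingNorm θ * slabBound r k) (iidPrior n r η) := (integrable_const _).add hi
  rw [← ofReal_integral_eq_lintegral_ofReal hi'
    (Eventually.of_forall fun θ => by positivity)]
  refine ENNReal.ofReal_le_ofReal (le_of_eq ?_)
  refine (integral_add (integrable_const _) hi).trans ?_
  rw [integral_const, probReal_univ, one_smul, integral_mul_const, iidPrior,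
    integral_hammingNorm h0.le (by linarith) hl.ne', hkη, riskUpper]
  ring

theorem exp_neg_lambdaE_le (h0 : 0 < η) (h1 : η ≤ 1 / 2) :
    Real.exp (-(lambdaE η ^ 2 / 2)) ≤ 2 * η := by
  have h := eq_mul_exp_lambdaE h0 h1
  nlinarith [Real.exp_pos (-(lambdaE η ^ 2 / 2))]

theorem le_bayesRisk (hr : r ≠ 0) (h1 : η < 1 / 2) (hk : 0 ≤ k)
    (hkη : Real.exp (-(k ^ 2 / 2)) = η) :
    ENNReal.ofReal (n * η * (spikeLower r k - 2)) ≤ bayesRisk r (iidPrior n r η) + 1 := by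
  have h0 : 0 < η := hkη ▸ Real.exp_pos _
  have hl := lambdaF_pos hr h0 h1
  rw [bayesRisk, ENNReal.iInf_add]
  refine le_iInf fun p => ?_
  have h := ofReal_le_setLIntegral_risk_add_one hr hl (lambdaF_sq_mul hr η) h0 (by linarith)
    (eq_mul_exp_lambdaE h0 h1.le) p Set.univ
  rw [setIntegral_univ, setLIntegral_univ, integral_hammingNorm h0.le (by linarith) hl.ne'] at h
  refine le_trans (ENNReal.ofReal_le_ofReal ?_) h
  have h2 := exp_neg_lambdaE_le h0 h1.le
  have h3 := spikeLower_le hr h0 le_rfl h1.le (by linarith) hk hkη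
  have h4 : (n : ℝ) * Real.exp (-(lambdaE η ^ 2 / 2)) ≤ n * (2 * η) := by gcongr
  have h5 : n * η * spikeLower r k ≤ n * η * spikeBound r (lambdaF r η) := by gcongr
  linarith

/-- Thinning the prior to (1-δ)η leaves a margin of δnη spikes before the sparse set is left; the
variance bound prices the excess at 1/δ + 1/δ². -/
theorem le_minimaxRisk (hr : r ≠ 0) (h1 : η < 1 / 2) (hk : 0 ≤ k)
    (hkη : Real.exp (-(k ^ 2 / 2)) = η) (hL : 0 ≤ spikeLower r k) {δ : ℝ} (hδ0 : 0 < δ)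
    (hδ1 : δ ≤ 1 / 2) (hn : 0 < n) :
    ENNReal.ofReal (((1 - δ) * (n * η) - 1 / δ - 1 / δ ^ 2) * spikeLower r k - 2 * (n * η)) ≤
      minimaxRisk r (sparseSet n (n * η)) + 1 := by
  have h0 : 0 < η := hkη ▸ Real.exp_pos _
  have hn' : (0 : ℝ) < n := Nat.cast_pos.mpr hn
  set η' := (1 - δ) * η with hη'
  have h0' : 0 < η' := mul_pos (by linarith) h0
  have hle : η' ≤ η := mul_le_of_le_one_left h0.le (by linarith)
  have hge : η ≤ 2 * η' := by rw [hη']; nlinarith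
  have hl := lambdaF_pos hr h0' (by linarith)
  have := isProbabilityMeasure_twoPointPrior h0'.le (by linarith) (lambdaF r η')
  have hd : 0 < δ * (n * η) := by positivity
  have hs : (n : ℝ) * η = n * η' + δ * (n * η) := by rw [hη']; ring
  have hq := le_setIntegral_hammingNorm (n := n) h0'.le (by linarith) hl.ne' hd
  rw [← hs] at hq
  set q := ∫ θ in sparseSet n (n * η), (hammingNorm θ : ℝ)
    ∂(Measure.pi fun _ : Fin n => twoPointPrior η' (lambdaF r η')) with hq_def
  have hq2 : (1 - δ) * (n * η) - 1 / δ - 1 / δ ^ 2 ≤ q := by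
    refine le_trans ?_ hq
    have e1 : n * η' * (1 / (δ * (n * η)) + n * η' / (δ * (n * η)) ^ 2) =
        (1 - δ) * (1 / δ) + (1 - δ) ^ 2 * (1 / δ ^ 2) := by
      rw [hη']; field_simp
    have e2 : (1 - δ) * (1 / δ) ≤ 1 * (1 / δ) :=
      mul_le_mul_of_nonneg_right (by linarith) (by positivity)
    have e3 : (1 - δ) ^ 2 * (1 / δ ^ 2) ≤ 1 * (1 / δ ^ 2) :=
      mul_le_mul_of_nonneg_right (by nlinarith) (by positivity)
    have e4 : (n : ℝ) * η' = (1 - δ) * (n * η) := by rw [hη']; ring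
    rw [e1, e4]
    linarith
  have hq0 : 0 ≤ q := integral_nonneg fun θ => Nat.cast_nonneg _
  rw [minimaxRisk, ENNReal.iInf_add]
  refine le_iInf fun p => ?_
  have h := ofReal_le_setLIntegral_risk_add_one hr hl (lambdaF_sq_mul hr η') h0' (by linarith)
    (eq_mul_exp_lambdaE h0' (by linarith)) p (sparseSet n (n * η))
  rw [← hq_def] at h
  refine (ENNReal.ofReal_le_ofReal ?_).trans (h.trans (add_le_add ?_ le_rfl))
  · have h2 := exp_neg_lambdaE_le h0' (by linarith)
    have h3 := spikeLower_le hr h0' hle h1.le hge hk hkη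
    have h4 : (n : ℝ) * Real.exp (-(lambdaE η' ^ 2 / 2)) ≤ n * (2 * η) := by
      gcongr; linarith
    have h5 : ((1 - δ) * (n * η) - 1 / δ - 1 / δ ^ 2) * spikeLower r k ≤ q * spikeLower r k :=
      mul_le_mul_of_nonneg_right hq2 hL
    have h6 : q * spikeLower r k ≤ q * spikeBound r (lambdaF r η') := by gcongr
    linarith
  -- The restricted prior has mass at most 1, so its average risk is at most the supremum.
  · refine (setLIntegral_mono' (measurableSet_sparseSet _ _)
      (g := fun _ => ⨆ θ ∈ sparseSet n (n * η), risk r θ p)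
      fun θ hθ => le_iSup₂ (f := fun θ _ => risk r θ p) θ hθ).trans ?_
    rw [setLIntegral_const]
    exact mul_le_of_le_one_right' prob_le_one

/-- Two-sided bounds on the minimax risk, as a real number. -/
theorem minimaxRisk_toReal_bounds (hr : r ≠ 0) (h1 : η < 1 / 2) (hk : 2 ≤ k)
    (hkη : Real.exp (-(k ^ 2 / 2)) = η) (hL : 0 ≤ spikeLower r k) {δ : ℝ} (hδ0 : 0 < δ)
    (hδ1 : δ ≤ 1 / 2) (hn : 0 < n) :
    ((1 - δ) * (n * η) - 1 / δ - 1 / δ ^ 2) * spikeLower r k - 2 * (n * η) - 1 ≤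
        (minimaxRisk r (sparseSet n (n * η))).toReal ∧
      (minimaxRisk r (sparseSet n (n * η))).toReal ≤ n * η * riskUpper r k := by
  have h0 : 0 < η := hkη ▸ Real.exp_pos _
  have hup := minimaxRisk_le (n := n) hr hk hkη
  have hlo := le_minimaxRisk hr h1 (by linarith) hkη hL hδ0 hδ1 hn
  have hfin := ne_top_of_le_ne_top ENNReal.ofReal_ne_top hup
  have hU : 0 ≤ n * η * riskUpper r k :=
    mul_nonneg (by positivity) (riskUpper_nonneg hr (by linarith))
  refine ⟨?_, ENNReal.toReal_le_of_le_ofReal hU hup⟩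
  rw [ENNReal.ofReal_le_iff_le_toReal (by finiteness), ENNReal.toReal_add hfin ENNReal.one_ne_top,
    ENNReal.toReal_one] at hlo
  linarith

/-- Two-sided bounds on the Bayes risk of the i.i.d. prior, as a real number. -/
theorem bayesRisk_toReal_bounds (hr : r ≠ 0) (h1 : η < 1 / 2) (hk : 2 ≤ k)
    (hkη : Real.exp (-(k ^ 2 / 2)) = η) :
    n * η * (spikeLower r k - 2) - 1 ≤ (bayesRisk r (iidPrior n r η)).toReal ∧
      (bayesRisk r (iidPrior n r η)).toReal ≤ n * η * riskUpper r k := by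
  have h0 : 0 < η := hkη ▸ Real.exp_pos _
  have hup := bayesRisk_le (n := n) hr hk hkη h1
  have hlo := le_bayesRisk (n := n) hr h1 (by linarith) hkη
  have hfin := ne_top_of_le_ne_top ENNReal.ofReal_ne_top hup
  have hU : 0 ≤ n * η * riskUpper r k :=
    mul_nonneg (by positivity) (riskUpper_nonneg hr (by linarith))
  refine ⟨?_, ENNReal.toReal_le_of_le_ofReal hU hup⟩
  rw [ENNReal.ofReal_le_iff_le_toReal (by finiteness), ENNReal.toReal_add hfin ENNReal.one_ne_top,
    ENNReal.toReal_one] at hlo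
  linarith

end Bounds

/-! ### Asymptotics -/

section Asymptotics

variable {r : ℝ≥0}

/-- The leading term of both risks: `s k² / (2 (1 + r))`. -/
noncomputable def leadingTerm (r : ℝ≥0) (s k : ℝ) : ℝ := s * (k ^ 2 / 2 / (1 + r))

theorem tendsto_riskUpper_div (r : ℝ≥0) :
    Tendsto (fun k => riskUpper r k / (k ^ 2 / 2 / (1 + r))) atTop (𝓝 1) := by
  have hlim : Tendsto (fun k : ℝ => 1 + (7 * k⁻¹ + (2 + Real.log ((1 + r) / r) / 2) * k⁻¹ ^ 2) *
      (2 * (1 + r))) atTop (𝓝 (1 + (7 * 0 + (2 + Real.log ((1 + r) / r) / 2) * 0 ^ 2) *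
      (2 * (1 + (r : ℝ))))) := by
    have hi : Tendsto (fun k : ℝ => k⁻¹) atTop (𝓝 0) := tendsto_inv_atTop_zero
    exact (((hi.const_mul 7).add ((hi.pow 2).const_mul _)).mul_const _).const_add 1
  have h0 : 1 + (7 * 0 + (2 + Real.log ((1 + r) / r) / 2) * 0 ^ 2) * (2 * (1 + (r : ℝ))) = 1 := by
    ring
  rw [h0] at hlim
  refine hlim.congr' ?_
  filter_upwards [eventually_gt_atTop 0] with k hk
  have hr1 : (0 : ℝ) < 1 + r := by positivity
  rw [riskUpper, slabBound]
  generalize Real.log ((1 + r) / r) = L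
  field_simp
  ring

theorem tendsto_spikeLower_div (hr : r ≠ 0) :
    Tendsto (fun k => spikeLower r k / (k ^ 2 / 2 / (1 + r))) atTop (𝓝 1) := by
  have hr' : (0 : ℝ) < r := by positivity
  have hlim : Tendsto (fun k : ℝ => 1 - 2 * k⁻¹ ^ 2 - (k⁻¹ ^ 2 + (k⁻¹ + 2 * k⁻¹ ^ 2) *
      (1 + (1 + r) / (2 * r))) * (2 * (1 + r))) atTop (𝓝 (1 - 2 * 0 ^ 2 -
      (0 ^ 2 + (0 + 2 * 0 ^ 2) * (1 + (1 + r) / (2 * r))) * (2 * (1 + (r : ℝ))))) := by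
    have hi : Tendsto (fun k : ℝ => k⁻¹) atTop (𝓝 0) := tendsto_inv_atTop_zero
    exact (((hi.pow 2).const_mul 2).const_sub 1).sub
      (((hi.pow 2).add ((hi.add ((hi.pow 2).const_mul 2)).mul_const _)).mul_const _)
  have h0 : 1 - 2 * 0 ^ 2 - (0 ^ 2 + (0 + 2 * 0 ^ 2) * (1 + (1 + r) / (2 * r))) *
      (2 * (1 + (r : ℝ))) = 1 := by ring
  rw [h0] at hlim
  refine hlim.congr' ?_
  filter_upwards [eventually_gt_atTop 0] with k hk
  have hr1 : (0 : ℝ) < 1 + r := by positivity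
  rw [spikeLower]
  field_simp
  ring

variable {s k : ℕ → ℝ}

/-- The choice δ = s^(-1/4) gives δ → 0 while 1/δ and 1/δ² are o(s); divided by s they become δ³ and
δ². -/
theorem tendsto_lower_minimax (hr : r ≠ 0) (hs : Tendsto s atTop atTop)
    (hk : Tendsto k atTop atTop) :
    Tendsto (fun n => ((((1 - (√√(s n))⁻¹) * s n - 1 / (√√(s n))⁻¹ - 1 / (√√(s n))⁻¹ ^ 2) *
      spikeLower r (k n) - 2 * s n - 1) / leadingTerm r (s n) (k n))) atTop (𝓝 1) := by
  have hw : Tendsto (fun n => (√√(s n))⁻¹) atTop (𝓝 0) :=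
    tendsto_inv_atTop_zero.comp
      (Real.tendsto_sqrt_atTop.comp (Real.tendsto_sqrt_atTop.comp hs))
  have hj : Tendsto (fun n => (k n)⁻¹) atTop (𝓝 0) := tendsto_inv_atTop_zero.comp hk
  have hM := (tendsto_spikeLower_div hr).comp hk
  have hlim := (((hw.const_sub 1).sub (hw.pow 3)).sub (hw.pow 2)).mul hM |>.sub
    (((hw.pow 4).const_add 2).mul (((hj.pow 2)).mul_const (2 * (1 + (r : ℝ)))))
  have h0 : ((1 - 0 : ℝ) - 0 ^ 3 - 0 ^ 2) * 1 - (2 + 0 ^ 4) * (0 ^ 2 * (2 * (1 + (r : ℝ)))) = 1 := by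
    ring
  rw [h0] at hlim
  refine hlim.congr' ?_
  filter_upwards [hs.eventually_gt_atTop 0, hk.eventually_gt_atTop 0] with n hsn hkn
  have hr1 : (0 : ℝ) < 1 + r := by positivity
  have hs4 : s n = √√(s n) ^ 4 := by
    rw [show 4 = 2 * 2 from rfl, pow_mul, Real.sq_sqrt (Real.sqrt_nonneg _), Real.sq_sqrt hsn.le]
  have hw0 : 0 < √√(s n) := Real.sqrt_pos.mpr (Real.sqrt_pos.mpr hsn)
  simp only [Function.comp_apply, leadingTerm]
  generalize √√(s n) = w at hs4 hw0
  rw [hs4]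
  field_simp
  ring

theorem tendsto_lower_bayes (hr : r ≠ 0) (hs : Tendsto s atTop atTop)
    (hk : Tendsto k atTop atTop) :
    Tendsto (fun n => (s n * (spikeLower r (k n) - 2) - 1) / leadingTerm r (s n) (k n))
      atTop (𝓝 1) := by
  have hi : Tendsto (fun n => (s n)⁻¹) atTop (𝓝 0) := tendsto_inv_atTop_zero.comp hs
  have hj : Tendsto (fun n => (k n)⁻¹) atTop (𝓝 0) := tendsto_inv_atTop_zero.comp hk
  have hM := (tendsto_spikeLower_div hr).comp hk
  have hlim := hM.sub ((hi.const_add 2).mul ((hj.pow 2).mul_const (2 * (1 + (r : ℝ)))))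
  have h0 : 1 - (2 + 0) * (0 ^ 2 * (2 * (1 + (r : ℝ)))) = 1 := by ring
  rw [h0] at hlim
  refine hlim.congr' ?_
  filter_upwards [hs.eventually_gt_atTop 0, hk.eventually_gt_atTop 0] with n hsn hkn
  have hr1 : (0 : ℝ) < 1 + r := by positivity
  simp only [Function.comp_apply, leadingTerm]
  field_simp
  ring

theorem tendsto_upper (hs : Tendsto s atTop atTop) (hk : Tendsto k atTop atTop) :
    Tendsto (fun n => s n * riskUpper r (k n) / leadingTerm r (s n) (k n)) atTop (𝓝 1) := by
  refine ((tendsto_riskUpper_div r).comp hk).congr' ?_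
  filter_upwards [hs.eventually_gt_atTop 0] with n hsn
  simp only [Function.comp_apply, leadingTerm]
  rw [mul_div_mul_left _ _ hsn.ne']

end Asymptotics

end SparsePrediction

/-! ### Comparison of both risks with the leading term -/

open SparsePrediction

theorem theorem2 (r : ℝ≥0) (hr : 0 < r) (s : ℕ → ℝ)
    (hs : Tendsto s atTop atTop)
    (hsn : Tendsto (fun n : ℕ => s n / (n : ℝ)) atTop (𝓝 0)) :
    (∀ᶠ n : ℕ in atTop,
      0 < SparsePrediction.minimaxRisk r (SparsePrediction.sparseSet n (s n)) ∧
      SparsePrediction.minimaxRisk r (SparsePrediction.sparseSet n (s n)) < ∞ ∧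
      SparsePrediction.bayesRisk r (SparsePrediction.iidPrior n r (s n / (n : ℝ))) < ∞) ∧
    ∃ ε : ℕ → ℝ, Tendsto ε atTop (𝓝 0) ∧
      ∀ᶠ n : ℕ in atTop,
        (SparsePrediction.bayesRisk r
            (SparsePrediction.iidPrior n r (s n / (n : ℝ)))).toReal =
          (SparsePrediction.minimaxRisk r
            (SparsePrediction.sparseSet n (s n))).toReal * (1 + ε n) := by
  have hr0 : r ≠ 0 := hr.ne'
  -- Using log(1/η) in place of log((1-η)/η) gives exp(-k²/2) = η exactly.
  set k : ℕ → ℝ := fun n => √(2 * Real.log (s n / n)⁻¹) with hk_def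
  have hpos : ∀ᶠ n : ℕ in atTop, 0 < n ∧ 0 < s n ∧ 0 < s n / n := by
    filter_upwards [eventually_gt_atTop 0, hs.eventually_gt_atTop 0] with n h1 h2
    exact ⟨h1, h2, div_pos h2 (Nat.cast_pos.mpr h1)⟩
  have hk : Tendsto k atTop atTop := by
    have h1 : Tendsto (fun n : ℕ => s n / (n : ℝ)) atTop (𝓝[>] 0) :=
      tendsto_nhdsWithin_iff.mpr ⟨hsn, hpos.mono fun n h => h.2.2⟩
    exact Real.tendsto_sqrt_atTop.comp
      ((Real.tendsto_log_atTop.comp h1.inv_tendsto_nhdsGT_zero).const_mul_atTop two_pos)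
  have hL : ∀ᶠ n in atTop, 0 ≤ spikeLower r (k n) := by
    have h := ((tendsto_spikeLower_div hr0).comp hk).eventually (lt_mem_nhds zero_lt_one)
    filter_upwards [h, hk.eventually_gt_atTop 0] with n hn hkn
    have h2 : 0 < k n ^ 2 / 2 / (1 + (r : ℝ)) := by positivity
    exact ((div_pos_iff_of_pos_right h2).mp hn).le
  have hmain : ∀ᶠ n : ℕ in atTop, 0 < n ∧ 0 < s n ∧ s n / n < 1 / 2 ∧ 2 ≤ k n ∧
      Real.exp (-(k n ^ 2 / 2)) = s n / n ∧ 0 ≤ spikeLower r (k n) ∧ 0 < (√√(s n))⁻¹ ∧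
      (√√(s n))⁻¹ ≤ 1 / 2 ∧ n * (s n / n) = s n := by
    filter_upwards [hpos, hsn.eventually (gt_mem_nhds (by norm_num : (0 : ℝ) < 1 / 2)),
      hk.eventually_ge_atTop 2, hL, (Real.tendsto_sqrt_atTop.comp
        (Real.tendsto_sqrt_atTop.comp hs)).eventually_ge_atTop 2] with n ⟨h1, h2, h3⟩ h4 h5 h6 h7
    refine ⟨h1, h2, h4, h5, ?_, h6, inv_pos.mpr (lt_of_lt_of_le two_pos h7), ?_, ?_⟩
    · have h8 : 0 ≤ Real.log (s n / n)⁻¹ :=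
        Real.log_nonneg ((one_le_inv₀ h3).mpr (by linarith))
      rw [hk_def]
      simp only
      rw [Real.sq_sqrt (by positivity), mul_div_cancel_left₀ _ two_ne_zero, Real.log_inv, neg_neg,
        Real.exp_log h3]
    · rw [one_div]
      exact inv_anti₀ two_pos h7
    · have : (n : ℝ) ≠ 0 := Nat.cast_ne_zero.mpr h1.ne'
      field_simp
  have hT : ∀ᶠ n : ℕ in atTop, 0 < leadingTerm r (s n) (k n) := by
    filter_upwards [hmain] with n ⟨_, h2, _, h5, _⟩
    unfold leadingTerm
    positivity
  have hR : Tendsto (fun n => (minimaxRisk r (sparseSet n (s n))).toReal /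
      leadingTerm r (s n) (k n)) atTop (𝓝 1) := by
    refine tendsto_of_tendsto_of_tendsto_of_le_of_le' (tendsto_lower_minimax hr0 hs hk)
      (tendsto_upper (r := r) hs hk) ?_ ?_
    all_goals
      filter_upwards [hmain, hT] with n ⟨h1, h2, h3, h4, h5, h6, h7, h8, h9⟩ hTn
      have h := minimaxRisk_toReal_bounds hr0 h3 h4 h5 h6 h7 h8 h1
      rw [h9] at h
      gcongr
    · exact h.1
    · exact h.2
  have hB : Tendsto (fun n : ℕ => (bayesRisk r (iidPrior n r (s n / n))).toReal /
      leadingTerm r (s n) (k n)) atTop (𝓝 1) := by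
    refine tendsto_of_tendsto_of_tendsto_of_le_of_le' (tendsto_lower_bayes hr0 hs hk)
      (tendsto_upper (r := r) hs hk) ?_ ?_
    all_goals
      filter_upwards [hmain, hT] with n ⟨h1, h2, h3, h4, h5, h6, h7, h8, h9⟩ hTn
      have h := bayesRisk_toReal_bounds (n := n) hr0 h3 h4 h5
      rw [h9] at h
      gcongr
    · exact h.1
    · exact h.2
  have hRpos : ∀ᶠ n in atTop, 0 < (minimaxRisk r (sparseSet n (s n))).toReal := by
    filter_upwards [hR.eventually (lt_mem_nhds zero_lt_one), hT] with n h1 h2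
    exact (div_pos_iff_of_pos_right h2).mp h1
  refine ⟨?_, fun n => (bayesRisk r (iidPrior n r (s n / n))).toReal /
    (minimaxRisk r (sparseSet n (s n))).toReal - 1, ?_, ?_⟩
  · filter_upwards [hmain, hRpos] with n ⟨h1, h2, h3, h4, h5, _, _, _, h9⟩ hRn
    have hm := minimaxRisk_le (n := n) hr0 h4 h5
    rw [h9] at hm
    exact ⟨(ENNReal.toReal_pos_iff.mp hRn).1, hm.trans_lt ENNReal.ofReal_lt_top,
      (bayesRisk_le hr0 h4 h5 h3).trans_lt ENNReal.ofReal_lt_top⟩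
  · have h := (hB.div hR one_ne_zero).sub_const 1
    rw [div_one, sub_self] at h
    refine h.congr' ?_
    filter_upwards [hT] with n hTn
    simp only [Pi.div_apply]
    rw [div_div_div_cancel_right₀ hTn.ne']
  · filter_upwards [hRpos] with n hRn
    rw [add_sub_cancel, mul_div_cancel₀ _ hRn.ne']
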